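/- **A priori Wasserstein guarantee for stochastic Lanczos quadrature (SLQ).** Let $A$ be a real symmetric $n\times n$ matrix ($n\ge 1$) with eigenvalues $\lambda_1,\dots,\lambda_n$, let $I[A]=|\lambda_{\max}-\lambda_{\min}|$, and let $\Phi[A](x)=\frac1n\#\{i:\lambda_i\le x\}$ be its cumulative empirical spectral measure (CESM). For a symmetric matrix $B$ and a vector $w$ put $\Psi[B,w](x)=w^{\mathsf T}\,\mathbb 1[B\le x]\,w$, where $\mathbb 1[B\le x]$ is the orthogonal projector onto the span of the eigenvectors of $B$ with eigenvalue at most $x$. For two distribution functions let $d_{\mathrm W}(\mu,\nu)=\int_{\mathbb R}|\mu(x)-\nu(x)|\,dx$. For a unit vector $v\in\mathbb R^n$ and $k\ge 1$, let $T_k(A,v)$ be the symmetric tridiagonal $k\times k$ matrix returned by $k$ steps of the Lanczos algorithm in exact arithmetic: with $q_0=0$, $\beta_0=0$, $q_1=v$ and, for $i=1,\dots,k$, $$\alpha_i=\langle Aq_i-\beta_{i-1}q_{i-1},\,q_i\rangle,\quad \tilde q_{i+1}=Aq_i-\beta_{i-1}q_{i-1}-\alpha_iq_i,\quad \beta_i=\|\tilde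 q_{i+1}\|,\quad q_{i+1}=\tilde q_{i+1}/\beta_i ,$$ $T_k(A,v)$ has diagonal $\alpha_1,\dots,\alpha_k$ and off-diagonal $\beta_1,\dots,\beta_{k-1}$ (if $\beta_i=0$ for some $i$, set $q_{i+1}=0$, so that all later coefficients are $0$). Optionally ("reorthogonalization"), $\tilde q_{i+1}$ is moreover orthogonalized against $q_1,\dots,q_{i-1}$ before it is normalized; the theorem is about both variants. Let $e=(1,0,\dots,0)^{\mathsf T}\in\mathbb R^k$. On input $A,n_{\mathrm v},k$, SLQ draws $v_1,\dots,v_{n_{\mathrm v}}$ independently from the uniform distribution on the unit sphere of $\mathbb R^n$ and returns the average of the $k$-point Gaussian quadrature rules, $$\widehat\Phi(x)=\frac1{n_{\mathrm v}}\sum_{i=1}^{n_{\mathrm v}}\Psi[T_k(A,v_i),e](x).$$ **Theorem.** Let $0<\eta<1$ and $t>0$, and let $n_{\mathrm v}$ and $k$ be integers with $$n_{\mathrm v}>4(n+2)^{-1}t^{-2}\ln(2n\eta^{-1}),\qquad k>12\,t^{-1}+\tfrac12 .$$ Then $$\mathbb P\big[\,d_{\mathrm W}(\Phi[A],\widehat\Phi)>t\,I[A]\,\big]<\eta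 .$$ -/

import Mathlib

open MeasureTheory ProbabilityTheory

namespace SLQ

noncomputable section

/-- The spectral projector `𝟙[B ≤ x]`: the matrix function `s ↦ 𝟙[s ≤ x]` applied to the real
symmetric matrix `B` through its eigenvalue decomposition. -/
def projLE {d : ℕ} {B : Matrix (Fin d) (Fin d) ℝ} (hB : B.IsHermitian) (x : ℝ) :
    Matrix (Fin d) (Fin d) ℝ :=
  hB.cfc (fun s => if s ≤ x then 1 else 0)

/-- The cumulative empirical spectral measure `Φ[B]`: `Φ[B](x)` is the fraction of the eigenvalues
of `B`, counted with multiplicity, that are at most `x`. -/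
def cesm {d : ℕ} {B : Matrix (Fin d) (Fin d) ℝ} (hB : B.IsHermitian) (x : ℝ) : ℝ :=
  ∑ i, (1 / (d : ℝ)) * (if hB.eigenvalues i ≤ x then 1 else 0)

/-- The weighted cumulative empirical spectral measure `Ψ[B, v](x) = vᵀ 𝟙[B ≤ x] v`. -/
def weightedCesm {d : ℕ} {B : Matrix (Fin d) (Fin d) ℝ} (hB : B.IsHermitian) (v : Fin d → ℝ)
    (x : ℝ) : ℝ :=
  dotProduct v (Matrix.mulVec (projLE hB x) v)

/-- `I[B] = |λ_max[B] - λ_min[B]|`. -/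
def spectralWidth {d : ℕ} {B : Matrix (Fin d) (Fin d) ℝ} (hB : B.IsHermitian) : ℝ :=
  |(⨆ i, hB.eigenvalues i) - (⨅ i, hB.eigenvalues i)|

/-- The Wasserstein distance `∫ |F(x) - G(x)| dx` between two distribution functions, with values
in `[0, ∞]`. -/
def wasserstein (F G : ℝ → ℝ) : ENNReal :=
  ∫⁻ x, ENNReal.ofReal |F x - G x|

/-- The uniform distribution on the unit sphere of `ℝⁿ`: normalized surface measure. -/
def uniformSphere (n : ℕ) : Measure (Metric.sphere (0 : EuclideanSpace ℝ (Fin n)) 1) :=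
  ((volume : Measure (EuclideanSpace ℝ (Fin n))).toSphere Set.univ)⁻¹ •
    (volume : Measure (EuclideanSpace ℝ (Fin n))).toSphere

/-- What the Lanczos algorithm holds when it starts step `i` (`i = 1, 2, …`): the vectors
`q_{i-1}, …, q_1` (most recent first), the coefficient `β_{i-1}` and the vector `q_i`. -/
structure LanczosState (n : ℕ) where
  past : List (EuclideanSpace ℝ (Fin n))
  beta : ℝ
  q : EuclideanSpace ℝ (Fin n)

namespace LanczosState

variable {n : ℕ}

/-- `A q_i - β_{i-1} q_{i-1}`, where `q_0 = 0`. -/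
def residual (A : Matrix (Fin n) (Fin n) ℝ) (s : LanczosState n) : EuclideanSpace ℝ (Fin n) :=
  Matrix.toEuclideanLin A s.q - s.beta • s.past.headD 0

/-- `α_i = ⟨A q_i - β_{i-1} q_{i-1}, q_i⟩`. -/
def alpha (A : Matrix (Fin n) (Fin n) ℝ) (s : LanczosState n) : ℝ :=
  inner ℝ (s.residual A) s.q

/-- The unnormalized next vector: `A q_i - β_{i-1} q_{i-1} - α_i q_i`, which is moreover
orthogonalized against `q_1, …, q_{i-1}` if the option `reorth` is on. -/
def qTilde (A : Matrix (Fin n) (Fin n) ℝ) (reorth : Bool) (s : LanczosState n) :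
    EuclideanSpace ℝ (Fin n) :=
  let w := s.residual A - s.alpha A • s.q
  if reorth then w - (s.past.map fun p => inner ℝ p w • p).sum else w

/-- One Lanczos step: `β_i` is the norm of the unnormalized next vector and `q_{i+1}` is that vector
divided by `β_i`. If `β_i = 0` (the Krylov space is exhausted) then `q_{i+1} = 0`, and all
later vectors and coefficients vanish too. -/
def next (A : Matrix (Fin n) (Fin n) ℝ) (reorth : Bool) (s : LanczosState n) : LanczosState n where
  past := s.q :: s.past
  beta := ‖s.qTilde A reorth‖
  q := ‖s.qTilde A reorth‖⁻¹ • s.qTilde A reorth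

/-- The start of the algorithm: `q_0 = 0`, `β_0 = 0` and `q_1 = v / ‖v‖`. -/
def init (v : EuclideanSpace ℝ (Fin n)) : LanczosState n where
  past := []
  beta := 0
  q := ‖v‖⁻¹ • v

end LanczosState

variable {n : ℕ}

/-- The Lanczos algorithm on `A`, `v` after `i` steps. -/
def lanczos (A : Matrix (Fin n) (Fin n) ℝ) (reorth : Bool) (v : EuclideanSpace ℝ (Fin n)) :
    ℕ → LanczosState n
  | 0 => LanczosState.init v
  | i + 1 => (lanczos A reorth v i).next A reorth

/-- The diagonal coefficients of Lanczos, numbered from `0`. -/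
def lanczosAlpha (A : Matrix (Fin n) (Fin n) ℝ) (reorth : Bool) (v : EuclideanSpace ℝ (Fin n))
    (i : ℕ) : ℝ :=
  (lanczos A reorth v i).alpha A

/-- The off-diagonal coefficients of Lanczos, numbered from `0`. -/
def lanczosBeta (A : Matrix (Fin n) (Fin n) ℝ) (reorth : Bool) (v : EuclideanSpace ℝ (Fin n))
    (i : ℕ) : ℝ :=
  (lanczos A reorth v (i + 1)).beta

/-- The tridiagonal matrix `[T]_{:k,:k}` that `k` steps of Lanczos on `A`, `v` return. If the Krylov
space is exhausted after `m < k` steps, this is the `m × m` Lanczos matrix padded with zeros, which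
leaves `Ψ[T, e]` as it is. -/
def lanczosT (A : Matrix (Fin n) (Fin n) ℝ) (reorth : Bool) (v : EuclideanSpace ℝ (Fin n))
    (k : ℕ) : Matrix (Fin k) (Fin k) ℝ :=
  Matrix.of fun i j =>
    if i = j then lanczosAlpha A reorth v i
    else if (i : ℕ) + 1 = j then lanczosBeta A reorth v i
    else if (j : ℕ) + 1 = i then lanczosBeta A reorth v j
    else 0

theorem lanczosT_isHermitian (A : Matrix (Fin n) (Fin n) ℝ) (reorth : Bool)
    (v : EuclideanSpace ℝ (Fin n)) (k : ℕ) : (lanczosT A reorth v k).IsHermitian := by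
  ext i j
  simp only [Matrix.conjTranspose_apply, lanczosT, Matrix.of_apply, star_trivial]
  rcases eq_or_ne i j with rfl | h
  · rfl
  · rw [if_neg h, if_neg h.symm]
    split_ifs <;> first | rfl | omega

/-- The first canonical unit vector `[1, 0, …, 0]ᵀ` of size `k`. -/
def e1 (k : ℕ) : Fin k → ℝ := fun i => if (i : ℕ) = 0 then 1 else 0

/-- The rule `Ψ[[T]_{:k,:k}, e]` obtained from `k` steps of Lanczos on `A`, `v`. -/
def lanczosQuadrature (A : Matrix (Fin n) (Fin n) ℝ) (reorth : Bool)
    (v : EuclideanSpace ℝ (Fin n)) (k : ℕ) : ℝ → ℝ :=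
  weightedCesm (lanczosT_isHermitian A reorth v k) (e1 k)

/-- The output of stochastic Lanczos quadrature on the sampled vectors `v 0, …, v (nv - 1)`: the
average of the quadrature rules. -/
def output (A : Matrix (Fin n) (Fin n) ℝ) (reorth : Bool) (k : ℕ) {nv : ℕ}
    (v : Fin nv → EuclideanSpace ℝ (Fin n)) (x : ℝ) : ℝ :=
  (1 / (nv : ℝ)) * ∑ i, lanczosQuadrature A reorth (v i) k x

end

end SLQ

/-! Put the average of the weighted measures `Ψ[A, v_i]` between `Φ[A]` and the SLQ output. The
triangle inequality separates a sampling error, which gets `3/4` of the budget `t`, from a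
quadrature error, which gets `1/4`.

Quadrature error (deterministic). `Ψ[B, w]` is a discrete measure on the eigenvalues of `B`. In
exact arithmetic the Lanczos vectors are orthogonal, so reorthogonalization changes nothing, and the
Lanczos matrix has the same moments as `Ψ[A, v]` in every degree below `2k` (`lanczosT_moments`).
Positivity keeps the charged nodes between the extreme eigenvalues of `A`. By Kantorovich–Rubinstein
it suffices to test against 1-Lipschitz functions, and Jackson's theorem with the Fejér–Korovkin
kernel replaces such a function by a polynomial of degree below `2k`. This gives `I[A] π / (2k + 1)`
for each sample (`wasserstein_quadrature_le`).

Sampling error (random). At a fixed `x`, `Ψ[A, v](x)` is the squared length of the projection of a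
uniform unit vector to a coordinate subspace: a Beta variable with mean `Φ[A](x)`. Its sub-Gaussian
bound is proved without a density. A linear rescaling of the subspace gives a one-parameter identity
for integrals over the sphere (`projSq_transform`), its derivative at parameter 1 is Stein's
identity, and Stein's identity gives a differential inequality for the moment generating function.
Hoeffding's bound and a union bound over the eigenvalues below the largest one finish the proof,
since both step functions are constant between consecutive eigenvalues and agree outside `[λ_min,
λ_max)`. -/

namespace SLQ

/-! ### Spectral weights and moments -/

/-- The squared coordinates of `v` in the eigenbasis of `B`. -/
noncomputable def specWeight {d : ℕ} {B : Matrix (Fin d) (Fin d) ℝ} (hB : B.IsHermitian)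
    (v : Fin d → ℝ) (i : Fin d) : ℝ :=
  (Matrix.mulVec (star (hB.eigenvectorUnitary : Matrix (Fin d) (Fin d) ℝ)) v i) ^ 2

theorem specWeight_nonneg {d : ℕ} {B : Matrix (Fin d) (Fin d) ℝ} (hB : B.IsHermitian)
    (v : Fin d → ℝ) (i : Fin d) : 0 ≤ specWeight hB v i := sq_nonneg _

/-- Diagonalization turns the quadratic form into integration against a discrete measure on the
spectrum. With indicators it yields `Ψ`, with powers the moments. -/
theorem dotProduct_cfc_mulVec {d : ℕ} {B : Matrix (Fin d) (Fin d) ℝ} (hB : B.IsHermitian)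
    (f : ℝ → ℝ) (v : Fin d → ℝ) :
    dotProduct v (Matrix.mulVec (hB.cfc f) v) = ∑ i, specWeight hB v i * f (hB.eigenvalues i) := by
  rw [Matrix.IsHermitian.cfc, Unitary.conjStarAlgAut_apply, ← Matrix.mulVec_mulVec,
    ← Matrix.mulVec_mulVec, Matrix.dotProduct_mulVec]
  have h : Matrix.vecMul v (hB.eigenvectorUnitary : Matrix (Fin d) (Fin d) ℝ) =
      Matrix.mulVec (star (hB.eigenvectorUnitary : Matrix (Fin d) (Fin d) ℝ)) v := by
    rw [Matrix.star_eq_conjTranspose, Matrix.conjTranspose_eq_transpose_of_trivial,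
      Matrix.mulVec_transpose]
  rw [h, dotProduct]
  refine Finset.sum_congr rfl fun i _ => ?_
  rw [Matrix.mulVec_diagonal, specWeight]
  simp
  ring

theorem cfc_pow_eq {d : ℕ} {B : Matrix (Fin d) (Fin d) ℝ} (hB : B.IsHermitian) (j : ℕ) :
    hB.cfc (fun x => x ^ j) = B ^ j := by
  conv_rhs => rw [hB.spectral_theorem, ← map_pow, Matrix.diagonal_pow]
  rw [Matrix.IsHermitian.cfc]
  congr 2

theorem sum_specWeight_mul_pow {d : ℕ} {B : Matrix (Fin d) (Fin d) ℝ} (hB : B.IsHermitian)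
    (v : Fin d → ℝ) (j : ℕ) :
    ∑ i, specWeight hB v i * hB.eigenvalues i ^ j = dotProduct v (Matrix.mulVec (B ^ j) v) := by
  rw [← cfc_pow_eq hB, dotProduct_cfc_mulVec]

theorem sum_specWeight {d : ℕ} {B : Matrix (Fin d) (Fin d) ℝ} (hB : B.IsHermitian)
    (v : Fin d → ℝ) : ∑ i, specWeight hB v i = dotProduct v v := by
  simpa using sum_specWeight_mul_pow hB v 0

theorem weightedCesm_eq_sum {d : ℕ} {B : Matrix (Fin d) (Fin d) ℝ} (hB : B.IsHermitian)
    (v : Fin d → ℝ) (x : ℝ) :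
    weightedCesm hB v x = ∑ i, specWeight hB v i * if hB.eigenvalues i ≤ x then 1 else 0 :=
  dotProduct_cfc_mulVec hB _ v

/-! ### Orthogonality and three-term recurrence of the Lanczos vectors -/

section Lanczos

variable {n : ℕ} (A : Matrix (Fin n) (Fin n) ℝ) (reorth : Bool) (v : EuclideanSpace ℝ (Fin n))

/-- The Lanczos vectors, numbered from `0`. -/
noncomputable def lanczosQ (i : ℕ) : EuclideanSpace ℝ (Fin n) := (lanczos A reorth v i).q

/-- The off-diagonal coefficient preceding step `i`, with value `0` for `i = 0`. -/
noncomputable def lanczosBetaPrev (i : ℕ) : ℝ := (lanczos A reorth v i).beta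

/-- The Lanczos vector preceding step `i`, with value `0` for `i = 0`. -/
noncomputable def lanczosQPrev (i : ℕ) : EuclideanSpace ℝ (Fin n) :=
  (lanczos A reorth v i).past.headD 0

theorem lanczosQPrev_succ (i : ℕ) : lanczosQPrev A reorth v (i + 1) = lanczosQ A reorth v i := rfl

theorem mem_past_lanczos (i : ℕ) (p : EuclideanSpace ℝ (Fin n))
    (hp : p ∈ (lanczos A reorth v i).past) : ∃ j < i, p = lanczosQ A reorth v j := by
  induction i with
  | zero => simp [lanczos, LanczosState.init] at hp
  | succ i ih =>
    rcases List.mem_cons.1 (show p ∈ (lanczos A reorth v i).q :: (lanczos A reorth v i).past from hp)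
      with h | h
    · exact ⟨i, i.lt_succ_self, h⟩
    · obtain ⟨j, hj, h⟩ := ih h
      exact ⟨j, hj.trans i.lt_succ_self, h⟩

theorem inner_toEuclideanLin_comm (hA : A.IsHermitian) (x y : EuclideanSpace ℝ (Fin n)) :
    inner ℝ (Matrix.toEuclideanLin A x) y = inner ℝ x (Matrix.toEuclideanLin A y) :=
  (Matrix.isSymmetric_toEuclideanLin_iff.2 hA) x y

/-- The next Lanczos vector before normalization, without reorthogonalization. -/
noncomputable def lanczosW (i : ℕ) : EuclideanSpace ℝ (Fin n) :=
  Matrix.toEuclideanLin A (lanczosQ A reorth v i)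
    - lanczosBetaPrev A reorth v i • lanczosQPrev A reorth v i
    - lanczosAlpha A reorth v i • lanczosQ A reorth v i

/-- Once orthogonality is known, every correction term of the reorthogonalization is zero, so the
two variants of the algorithm coincide. -/
theorem qTilde_eq_lanczosW (i : ℕ)
    (h : ∀ j < i, inner ℝ (lanczosQ A reorth v j) (lanczosW A reorth v i) = 0) :
    (lanczos A reorth v i).qTilde A reorth = lanczosW A reorth v i := by
  unfold LanczosState.qTilde
  change (if reorth = true then lanczosW A reorth v i - (List.map (fun p =>
    inner ℝ p (lanczosW A reorth v i) • p) (lanczos A reorth v i).past).sum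
    else lanczosW A reorth v i) = _
  split_ifs
  · rw [List.sum_eq_zero, sub_zero]
    intro x hx
    obtain ⟨p, hp, rfl⟩ := List.mem_map.1 hx
    obtain ⟨j, hj, rfl⟩ := mem_past_lanczos A reorth v i p hp
    rw [h j hj, zero_smul]
  · rfl

theorem lanczosBetaPrev_succ (i : ℕ) :
    lanczosBetaPrev A reorth v (i + 1) = ‖(lanczos A reorth v i).qTilde A reorth‖ := rfl

theorem lanczosQ_succ (i : ℕ) :
    lanczosQ A reorth v (i + 1) = ‖(lanczos A reorth v i).qTilde A reorth‖⁻¹ •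
      (lanczos A reorth v i).qTilde A reorth := rfl

theorem beta_smul_lanczosQ_succ (i : ℕ) :
    lanczosBetaPrev A reorth v (i + 1) • lanczosQ A reorth v (i + 1)
      = (lanczos A reorth v i).qTilde A reorth := by
  rw [lanczosBetaPrev_succ, lanczosQ_succ, smul_smul]
  rcases eq_or_ne ((lanczos A reorth v i).qTilde A reorth) 0 with h | h
  · simp [h]
  · rw [mul_inv_cancel₀ (norm_ne_zero_iff.2 h), one_smul]

/-- The value 0 records breakdown: since `0⁻¹ = 0`, normalizing the zero vector returns zero. -/
theorem lanczosQ_zero_or_norm (i : ℕ) : lanczosQ A reorth v i = 0 ∨ ‖lanczosQ A reorth v i‖ = 1 := by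
  have key : ∀ x : EuclideanSpace ℝ (Fin n), ‖x‖⁻¹ • x = 0 ∨ ‖‖x‖⁻¹ • x‖ = 1 := by
    intro x
    rcases eq_or_ne x 0 with h | h
    · simp [h]
    · right
      rw [norm_smul, norm_inv, norm_norm, inv_mul_cancel₀ (norm_ne_zero_iff.2 h)]
  cases i with
  | zero => exact key v
  | succ i => exact key _

theorem lanczosBetaPrev_eq_zero (i : ℕ) (h : lanczosQ A reorth v i = 0) :
    lanczosBetaPrev A reorth v i = 0 := by
  cases i with
  | zero => rfl
  | succ i =>
    rw [lanczosBetaPrev_succ, norm_eq_zero, ← beta_smul_lanczosQ_succ, h, smul_zero]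

theorem lanczosAlpha_eq (i : ℕ) : lanczosAlpha A reorth v i =
    inner ℝ (Matrix.toEuclideanLin A (lanczosQ A reorth v i)
      - lanczosBetaPrev A reorth v i • lanczosQPrev A reorth v i) (lanczosQ A reorth v i) := rfl

theorem lanczosQ_succ_eq_zero (i : ℕ)
    (hW : (lanczos A reorth v i).qTilde A reorth = lanczosW A reorth v i)
    (h : lanczosQ A reorth v i = 0) : lanczosQ A reorth v (i + 1) = 0 := by
  rw [lanczosQ_succ, hW, lanczosW, h, lanczosBetaPrev_eq_zero A reorth v i h]
  simp

/-- The two claims need each other. Orthogonality of the next vector rests on the recurrence for the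
earlier steps, and that recurrence holds under reorthogonalization only because of orthogonality. -/
theorem lanczos_invariant (hA : A.IsHermitian) (i : ℕ) :
    (∀ j < i, inner ℝ (lanczosQ A reorth v j) (lanczosQ A reorth v i) = 0) ∧
    (∀ j < i, (lanczos A reorth v j).qTilde A reorth = lanczosW A reorth v j) := by
  induction i using Nat.strong_induction_on with
  | _ i ih =>
  cases i with
  | zero => simp
  | succ i =>
    have hprev : ∀ j < i, (lanczos A reorth v j).qTilde A reorth = lanczosW A reorth v j :=
      (ih i i.lt_succ_self).2
    have horth : ∀ j ≤ i, ∀ l ≤ i, j ≠ l →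
        inner ℝ (lanczosQ A reorth v j) (lanczosQ A reorth v l) = 0 := by
      intro j hj l hl hjl
      rcases lt_or_gt_of_ne hjl with h | h
      · exact (ih l (by omega)).1 j h
      · rw [real_inner_comm]; exact (ih j (by omega)).1 l h
    have hA' : ∀ j < i, Matrix.toEuclideanLin A (lanczosQ A reorth v j) =
        lanczosBetaPrev A reorth v j • lanczosQPrev A reorth v j
        + lanczosAlpha A reorth v j • lanczosQ A reorth v j
        + lanczosBetaPrev A reorth v (j + 1) • lanczosQ A reorth v (j + 1) := by
      intro j hj
      rw [beta_smul_lanczosQ_succ, hprev j hj, lanczosW]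
      abel
    have hpp : ∀ j < i, inner ℝ (lanczosQPrev A reorth v j) (lanczosQ A reorth v i) = 0 := by
      intro j hj
      cases j with
      | zero => simp [lanczosQPrev, lanczos, LanczosState.init]
      | succ j => exact horth j (by omega) i le_rfl (by omega)
    have hw : ∀ j ≤ i, inner ℝ (lanczosQ A reorth v j) (lanczosW A reorth v i) = 0 := by
      intro j hj
      rcases hj.eq_or_lt with rfl | hj
      · rw [lanczosW, inner_sub_right, real_inner_smul_right, real_inner_comm,
          ← lanczosAlpha_eq]
        rcases lanczosQ_zero_or_norm A reorth v j with h | h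
        · rw [lanczosAlpha_eq, h]; simp
        · rw [real_inner_self_eq_norm_sq, h]; ring
      -- Symmetry moves `A` onto `q_j`, and the recurrence for `A q_j` leaves only its `q_{j+1}`
      -- term. That term matters only for `j = i - 1`, where it cancels against the subtracted
      -- multiple of `q_{i-1}`; after breakdown both are zero.
      · rw [lanczosW, inner_sub_right, inner_sub_right, real_inner_smul_right,
          real_inner_smul_right, horth j hj.le i le_rfl hj.ne, ← inner_toEuclideanLin_comm A hA,
          hA' j hj, inner_add_left, inner_add_left, real_inner_smul_left, real_inner_smul_left,
          real_inner_smul_left, hpp j hj, horth j hj.le i le_rfl hj.ne]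
        obtain ⟨m, rfl⟩ : ∃ m, i = m + 1 := ⟨i - 1, by omega⟩
        rw [lanczosQPrev_succ]
        rcases (Nat.lt_succ_iff.1 hj).eq_or_lt with rfl | hjm
        · rcases lanczosQ_zero_or_norm A reorth v (j + 1) with h | h
          · rw [lanczosBetaPrev_eq_zero A reorth v _ h]; simp
          · rcases lanczosQ_zero_or_norm A reorth v j with h' | h'
            · rw [lanczosQ_succ_eq_zero A reorth v j (hprev j hj) h'] at h
              simp at h
            · rw [real_inner_self_eq_norm_sq, real_inner_self_eq_norm_sq, h, h']; ring
        · rw [horth (j + 1) (by omega) (m + 1) le_rfl (by omega),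
            horth j (by omega) m (by omega) (by omega)]
          ring
    have hW : (lanczos A reorth v i).qTilde A reorth = lanczosW A reorth v i :=
      qTilde_eq_lanczosW A reorth v i fun j hj => hw j hj.le
    refine ⟨fun j hj => ?_, fun j hj => ?_⟩
    · rw [lanczosQ_succ, real_inner_smul_right, hW, hw j (by omega), mul_zero]
    · rcases (Nat.lt_succ_iff.1 hj).eq_or_lt with rfl | h
      · exact hW
      · exact hprev j h

theorem inner_lanczosQ (hA : A.IsHermitian) (i j : ℕ) (hij : i ≠ j) :
    inner ℝ (lanczosQ A reorth v i) (lanczosQ A reorth v j) = 0 := by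
  rcases lt_or_gt_of_ne hij with h | h
  · exact (lanczos_invariant A reorth v hA j).1 i h
  · rw [real_inner_comm]; exact (lanczos_invariant A reorth v hA i).1 j h

theorem lanczosQ_succ_eq_zero_of_eq_zero (hA : A.IsHermitian) (i : ℕ)
    (h : lanczosQ A reorth v i = 0) : lanczosQ A reorth v (i + 1) = 0 :=
  lanczosQ_succ_eq_zero A reorth v i ((lanczos_invariant A reorth v hA (i + 1)).2 i i.lt_succ_self) h

theorem toEuclideanLin_lanczosQ (hA : A.IsHermitian) (i : ℕ) :
    Matrix.toEuclideanLin A (lanczosQ A reorth v i) =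
      lanczosBetaPrev A reorth v i • lanczosQPrev A reorth v i
      + lanczosAlpha A reorth v i • lanczosQ A reorth v i
      + lanczosBeta A reorth v i • lanczosQ A reorth v (i + 1) := by
  change _ = _ + _ + lanczosBetaPrev A reorth v (i + 1) • lanczosQ A reorth v (i + 1)
  rw [beta_smul_lanczosQ_succ, (lanczos_invariant A reorth v hA (i + 1)).2 i i.lt_succ_self, lanczosW]
  abel

end Lanczos

/-! ### Gaussian quadrature: exactness of the Lanczos matrix -/

section Moments

variable {n : ℕ} (A : Matrix (Fin n) (Fin n) ℝ) (reorth : Bool) (v : EuclideanSpace ℝ (Fin n))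

/-- The linear combination of the first `k` Lanczos vectors with coefficients `x`. -/
noncomputable def lanczosComb {k : ℕ} (x : Fin k → ℝ) : EuclideanSpace ℝ (Fin n) :=
  ∑ l : Fin k, x l • lanczosQ A reorth v l

/-- This is `A Q = Q T + β q eᵀ` read column by column. Truncating `T` drops one term of the
recurrence, in the last column only. -/
theorem sum_lanczosT_smul (hA : A.IsHermitian) {m : ℕ} (j : Fin (m + 1)) :
    ∑ l, lanczosT A reorth v (m + 1) l j • lanczosQ A reorth v l =
      Matrix.toEuclideanLin A (lanczosQ A reorth v j) -
        if (j : ℕ) = m then lanczosBeta A reorth v m • lanczosQ A reorth v (m + 1) else 0 := by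
  obtain ⟨j, hj⟩ := j
  have h1 : ∀ l : Fin (m + 1), lanczosT A reorth v (m + 1) l ⟨j, hj⟩ • lanczosQ A reorth v l =
      (fun l : ℕ => (if l = j then lanczosAlpha A reorth v j • lanczosQ A reorth v j else 0)
        + (if l + 1 = j then lanczosBeta A reorth v l • lanczosQ A reorth v l else 0)
        + (if l = j + 1 then lanczosBeta A reorth v j • lanczosQ A reorth v (j + 1) else 0)) l := by
    rintro ⟨l, hl⟩
    simp only [lanczosT, Matrix.of_apply, Fin.mk.injEq]
    by_cases h : l = j
    · subst h; simp
    · by_cases h' : l + 1 = j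
      · simp [h, h', show ¬ l = j + 1 by omega]
      · by_cases h'' : l = j + 1
        · subst h''; simp [show ¬ j + 1 + 1 = j by omega]
        · simp [h, h', h'', show ¬ j + 1 = l by omega]
  rw [Finset.sum_congr rfl fun l _ => h1 l, Fin.sum_univ_eq_sum_range (fun l : ℕ =>
    (if l = j then lanczosAlpha A reorth v j • lanczosQ A reorth v j else 0)
        + (if l + 1 = j then lanczosBeta A reorth v l • lanczosQ A reorth v l else 0)
        + (if l = j + 1 then lanczosBeta A reorth v j • lanczosQ A reorth v (j + 1) else 0)),
    Finset.sum_add_distrib, Finset.sum_add_distrib, Finset.sum_ite_eq', Finset.sum_ite_eq',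
    toEuclideanLin_lanczosQ A reorth v hA]
  have h2 : ∑ l ∈ Finset.range (m + 1),
      (if l + 1 = j then lanczosBeta A reorth v l • lanczosQ A reorth v l else 0) =
      lanczosBetaPrev A reorth v j • lanczosQPrev A reorth v j := by
    cases j with
    | zero => simp [lanczosBetaPrev, lanczos, LanczosState.init]
    | succ j =>
      simp only [Nat.add_right_cancel_iff, Finset.sum_ite_eq']
      rw [if_pos (Finset.mem_range.2 (by omega))]
      rfl
  rw [h2, if_pos (Finset.mem_range.2 hj)]
  by_cases h : j = m
  · subst h; simp; abel
  · simp only [Finset.mem_range, h, if_false, sub_zero, show j + 1 < m + 1 by omega, if_true]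
    abel

theorem toEuclideanLin_lanczosComb (hA : A.IsHermitian) {m : ℕ} (x : Fin (m + 1) → ℝ) :
    Matrix.toEuclideanLin A (lanczosComb A reorth v x) =
      lanczosComb A reorth v (Matrix.mulVec (lanczosT A reorth v (m + 1)) x) +
        (x (Fin.last m) * lanczosBeta A reorth v m) • lanczosQ A reorth v (m + 1) := by
  have h : lanczosComb A reorth v (Matrix.mulVec (lanczosT A reorth v (m + 1)) x) =
      ∑ j, x j • ∑ l, lanczosT A reorth v (m + 1) l j • lanczosQ A reorth v l := by
    simp only [lanczosComb, Matrix.mulVec, dotProduct, Finset.sum_smul, Finset.smul_sum]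
    rw [Finset.sum_comm]
    refine Finset.sum_congr rfl fun j _ => Finset.sum_congr rfl fun l _ => ?_
    rw [smul_smul, mul_comm]
  have h2 : ∑ j : Fin (m + 1), x j • (if (j : ℕ) = m then
      lanczosBeta A reorth v m • lanczosQ A reorth v (m + 1) else 0) =
      (x (Fin.last m) * lanczosBeta A reorth v m) • lanczosQ A reorth v (m + 1) := by
    rw [Finset.sum_eq_single (Fin.last m), if_pos (Fin.val_last m), smul_smul]
    · exact fun j _ hj => by rw [if_neg (show ¬ (j : ℕ) = m from fun h => hj (Fin.ext h)), smul_zero]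
    · simp
  rw [h]
  simp only [sum_lanczosT_smul A reorth v hA, smul_sub, Finset.sum_sub_distrib, h2, lanczosComb,
    map_sum, map_smul, sub_add_cancel]

/-- The vectors `T ^ j e` for the Lanczos matrix `T`. -/
noncomputable def lanczosKrylov (k j : ℕ) : Fin k → ℝ :=
  Matrix.mulVec (lanczosT A reorth v k ^ j) (e1 k)

theorem lanczosKrylov_succ (k j : ℕ) : lanczosKrylov A reorth v k (j + 1) =
    Matrix.mulVec (lanczosT A reorth v k) (lanczosKrylov A reorth v k j) := by
  rw [lanczosKrylov, pow_succ', ← Matrix.mulVec_mulVec]; rfl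

/-- `T` is tridiagonal, so each multiplication extends the support of `e` by at most one coordinate.
-/
theorem lanczosKrylov_eq_zero_of_lt (k j : ℕ) (l : Fin k) (h : j < l) :
    lanczosKrylov A reorth v k j l = 0 := by
  induction j generalizing l with
  | zero => simp [lanczosKrylov, e1]; omega
  | succ j ih =>
    rw [lanczosKrylov_succ, Matrix.mulVec, dotProduct]
    refine Finset.sum_eq_zero fun i _ => ?_
    by_cases hi : j < i
    · rw [ih i hi, mul_zero]
    · have : lanczosT A reorth v k l i = 0 := by
        simp only [lanczosT, Matrix.of_apply, Fin.ext_iff]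
        rw [if_neg (by omega), if_neg (by omega), if_neg (by omega)]
      rw [this, zero_mul]

/-- After breakdown the corresponding rows of `T` vanish, so the zero padding is never reached from
`e`. This makes `inner_lanczosComb` applicable without assuming that the Krylov space has full
dimension. -/
theorem lanczosKrylov_eq_zero_of_lanczosQ (hA : A.IsHermitian) (hv : ‖v‖ = 1) (k j : ℕ) (l : Fin k)
    (h : lanczosQ A reorth v l = 0) : lanczosKrylov A reorth v k j l = 0 := by
  cases j with
  | zero =>
    have : (l : ℕ) ≠ 0 := by
      intro h0
      rw [h0] at h
      have h' : ‖v‖⁻¹ • v = 0 := h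
      rw [hv, inv_one, one_smul] at h'
      simp [h'] at hv
    simp [lanczosKrylov, e1, this]
  | succ j =>
    rw [lanczosKrylov_succ, Matrix.mulVec, dotProduct]
    refine Finset.sum_eq_zero fun i _ => ?_
    have : lanczosT A reorth v k l i = 0 := by
      simp only [lanczosT, Matrix.of_apply]
      split_ifs with h1 h2 h3
      · rw [lanczosAlpha_eq, h]; simp
      · exact lanczosBetaPrev_eq_zero A reorth v (l + 1)
          (lanczosQ_succ_eq_zero_of_eq_zero A reorth v hA l h)
      · exact lanczosBetaPrev_eq_zero A reorth v (i + 1) (h3 ▸ h)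
      · rfl
    rw [this, zero_mul]

theorem inner_lanczosComb (hA : A.IsHermitian) {k : ℕ} (x y : Fin k → ℝ)
    (hx : ∀ l : Fin k, lanczosQ A reorth v l = 0 → x l = 0) :
    inner ℝ (lanczosComb A reorth v x) (lanczosComb A reorth v y) = dotProduct x y := by
  simp only [lanczosComb, sum_inner, inner_sum, dotProduct]
  refine Finset.sum_congr rfl fun l _ => ?_
  rw [Finset.sum_eq_single l]
  · rw [real_inner_smul_left, real_inner_smul_right, real_inner_self_eq_norm_sq]
    rcases lanczosQ_zero_or_norm A reorth v l with h | h
    · rw [hx l h]; ring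
    · rw [h]; ring
  · intro b _ hb
    rw [real_inner_smul_left, real_inner_smul_right,
      inner_lanczosQ A reorth v hA _ _ (fun h => hb (Fin.ext h))]
    ring
  · simp

/-- For `j < m` the last coordinate of `T ^ j e` is zero, so the truncation term is absent and
applying `A` corresponds to applying `T`. -/
theorem lanczosComb_lanczosKrylov (hA : A.IsHermitian) (hv : ‖v‖ = 1) (m j : ℕ) (hj : j ≤ m) :
    lanczosComb A reorth v (lanczosKrylov A reorth v (m + 1) j) =
      (Matrix.toEuclideanLin A ^ j) v := by
  induction j with
  | zero =>
    have h0 : lanczosQ A reorth v 0 = v := by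
      change ‖v‖⁻¹ • v = v
      rw [hv, inv_one, one_smul]
    simp [lanczosComb, lanczosKrylov, e1, h0]
  | succ j ih =>
    have h := toEuclideanLin_lanczosComb A reorth v hA (lanczosKrylov A reorth v (m + 1) j)
    rw [lanczosKrylov_eq_zero_of_lt A reorth v _ _ (Fin.last m) (by simp; omega), zero_mul,
      zero_smul, add_zero, ih (by omega)] at h
    rw [lanczosKrylov_succ, ← h, pow_succ']
    rfl

theorem inner_pow_pow (hA : A.IsHermitian) (i j : ℕ) :
    inner ℝ ((Matrix.toEuclideanLin A ^ i) v) ((Matrix.toEuclideanLin A ^ j) v) =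
      inner ℝ v ((Matrix.toEuclideanLin A ^ (i + j)) v) := by
  induction i generalizing j with
  | zero => simp
  | succ i ih =>
    rw [pow_succ', Module.End.mul_apply, inner_toEuclideanLin_comm A hA, ← Module.End.mul_apply,
      ← pow_succ', ih, show i + 1 + j = i + (j + 1) by ring]

theorem dotProduct_pow_mulVec (i j : ℕ) (k : ℕ) :
    dotProduct (lanczosKrylov A reorth v k i) (lanczosKrylov A reorth v k j) =
      dotProduct (e1 k) (Matrix.mulVec (lanczosT A reorth v k ^ (i + j)) (e1 k)) := by
  induction i generalizing j with
  | zero => simp [lanczosKrylov]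
  | succ i ih =>
    rw [lanczosKrylov_succ, show i + 1 + j = i + (j + 1) by ring, ← ih, lanczosKrylov_succ,
      Matrix.dotProduct_mulVec, ← Matrix.mulVec_transpose,
      ← Matrix.conjTranspose_eq_transpose_of_trivial, lanczosT_isHermitian]

theorem inner_toEuclideanLin_pow (i : ℕ) :
    inner ℝ v ((Matrix.toEuclideanLin A ^ i) v) = dotProduct v (Matrix.mulVec (A ^ i) v) := by
  have h : ∀ i, ((Matrix.toEuclideanLin A ^ i) v).ofLp = Matrix.mulVec (A ^ i) v := by
    intro i
    induction i with
    | zero => simp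
    | succ i ih =>
      rw [pow_succ', Module.End.mul_apply, pow_succ', ← Matrix.mulVec_mulVec, ← ih]
      rfl
  rw [EuclideanSpace.inner_eq_star_dotProduct, h, star_trivial, dotProduct_comm]

/-- Gaussian quadrature: the Lanczos matrix reproduces the moments of degree less than `2 k`. -/
theorem lanczosT_moments (hA : A.IsHermitian) (hv : ‖v‖ = 1) (k i : ℕ) (hi : i < 2 * k) :
    dotProduct (e1 k) (Matrix.mulVec (lanczosT A reorth v k ^ i) (e1 k)) =
      dotProduct v (Matrix.mulVec (A ^ i) v) := by
  obtain ⟨m, rfl⟩ : ∃ m, k = m + 1 := ⟨k - 1, by omega⟩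
  rw [← inner_toEuclideanLin_pow A v]
  have hx := fun j => lanczosKrylov_eq_zero_of_lanczosQ A reorth v hA hv (m + 1) j
  -- Up to degree `2m` the exponent splits into two halves of size at most `m`, both represented
  -- exactly by Lanczos combinations.
  rcases Nat.lt_or_ge i (2 * m + 1) with h | h
  · obtain ⟨a, b, ha, hb, rfl⟩ : ∃ a b, a ≤ m ∧ b ≤ m ∧ i = a + b :=
      ⟨min i m, i - min i m, by omega, by omega, by omega⟩
    rw [← dotProduct_pow_mulVec, ← inner_pow_pow A v hA,
      ← lanczosComb_lanczosKrylov A reorth v hA hv m a ha,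
      ← lanczosComb_lanczosKrylov A reorth v hA hv m b hb,
      inner_lanczosComb A reorth v hA _ _ (hx a)]
  -- In the top degree `2m + 1` one factor needs `A` once more. The resulting truncation term is a
  -- multiple of `q_{m+1}`, orthogonal to the other factor.
  · obtain rfl : i = m + (m + 1) := by omega
    have hq : ∀ x : Fin (m + 1) → ℝ,
        inner ℝ (lanczosComb A reorth v x) (lanczosQ A reorth v (m + 1)) = 0 := by
      intro x
      rw [lanczosComb, sum_inner]
      refine Finset.sum_eq_zero fun l _ => ?_
      rw [real_inner_smul_left, inner_lanczosQ A reorth v hA _ _ l.2.ne, mul_zero]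
    rw [← dotProduct_pow_mulVec, ← inner_pow_pow A v hA, pow_succ', Module.End.mul_apply,
      ← lanczosComb_lanczosKrylov A reorth v hA hv m m le_rfl,
      toEuclideanLin_lanczosComb A reorth v hA, inner_add_right, real_inner_smul_right, hq,
      mul_zero, add_zero, ← lanczosKrylov_succ, inner_lanczosComb A reorth v hA _ _ (hx m)]

theorem lanczosT_polynomial_moments (hA : A.IsHermitian) (hv : ‖v‖ = 1) (k : ℕ)
    (p : Polynomial ℝ) (hp : p.natDegree < 2 * k) :
    ∑ i, specWeight (lanczosT_isHermitian A reorth v k) (e1 k) i *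
        p.eval ((lanczosT_isHermitian A reorth v k).eigenvalues i) =
      ∑ i, specWeight hA v i * p.eval (hA.eigenvalues i) := by
  have h : ∀ {d : ℕ} {B : Matrix (Fin d) (Fin d) ℝ} (hB : B.IsHermitian) (w : Fin d → ℝ),
      ∑ i, specWeight hB w i * p.eval (hB.eigenvalues i) =
        ∑ j ∈ Finset.range (p.natDegree + 1), p.coeff j *
          dotProduct w (Matrix.mulVec (B ^ j) w) := by
    intro d B hB w
    simp only [Polynomial.eval_eq_sum_range, Finset.mul_sum, ← sum_specWeight_mul_pow hB]
    rw [Finset.sum_comm]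
    refine Finset.sum_congr rfl fun j _ => Finset.sum_congr rfl fun i _ => ?_
    ring
  rw [h, h]
  refine Finset.sum_congr rfl fun j hj => ?_
  rw [lanczosT_moments A reorth v hA hv k j (by have := Finset.mem_range.1 hj; omega)]

end Moments

/-! ### Jackson's theorem by the Fejér–Korovkin kernel -/

section Jackson
open Real Polynomial

/-- Coefficients of the Fejér–Korovkin kernel. -/
noncomputable def korovkinCoeff (L : ℕ) (l : ℤ) : ℝ := sin (l * (π / (L + 1)))

/-- The Fejér–Korovkin kernel `|∑ a_l e^{ilu}|²`. -/
noncomputable def korovkinKernel (L : ℕ) (u : ℝ) : ℝ :=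
  ∑ l ∈ Finset.Icc (1 : ℤ) L, ∑ m ∈ Finset.Icc (1 : ℤ) L,
    korovkinCoeff L l * korovkinCoeff L m * cos ((l - m : ℤ) * u)

theorem korovkinKernel_nonneg (L : ℕ) (u : ℝ) : 0 ≤ korovkinKernel L u := by
  have : korovkinKernel L u = (∑ l ∈ Finset.Icc (1 : ℤ) L, korovkinCoeff L l * cos (l * u)) ^ 2 +
      (∑ l ∈ Finset.Icc (1 : ℤ) L, korovkinCoeff L l * sin (l * u)) ^ 2 := by
    rw [sq, sq, Finset.sum_mul_sum, Finset.sum_mul_sum, ← Finset.sum_add_distrib, korovkinKernel]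
    refine Finset.sum_congr rfl fun l _ => ?_
    rw [← Finset.sum_add_distrib]
    refine Finset.sum_congr rfl fun m _ => ?_
    push_cast
    rw [sub_mul, cos_sub]
    ring
  rw [this]
  positivity

theorem continuous_korovkinKernel (L : ℕ) : Continuous (korovkinKernel L) := by
  unfold korovkinKernel
  fun_prop

theorem integral_cos_int_mul_sub (n : ℤ) (θ : ℝ) :
    ∫ φ in -π..π, cos (n * (θ - φ)) = if n = 0 then 2 * π else 0 := by
  split_ifs with h
  · subst h
    simp
    ring
  · have hn : (n : ℝ) ≠ 0 := by exact_mod_cast h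
    have hd : ∀ φ : ℝ, HasDerivAt (fun φ => -sin (n * (θ - φ)) / n) (cos (n * (θ - φ))) φ := by
      intro φ
      have h1 := (((hasDerivAt_id φ).const_sub θ).const_mul (n : ℝ)).sin.neg.div_const (n : ℝ)
      convert! h1 using 1
      simp only [id]
      field_simp
    rw [intervalIntegral.integral_eq_sub_of_hasDerivAt (fun φ _ => hd φ)
      (Continuous.intervalIntegrable (by fun_prop) _ _)]
    have : (n : ℝ) * (θ - -π) = n * (θ - π) + n * (2 * π) := by ring
    rw [this, sin_add_int_mul_two_pi]
    ring

/-- The sum of squares of the coefficients of the Fejér–Korovkin kernel. -/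
noncomputable def korovkinMass (L : ℕ) : ℝ :=
  ∑ l ∈ Finset.Icc (1 : ℤ) L, korovkinCoeff L l ^ 2

theorem korovkinMass_pos (L : ℕ) (hL : 1 ≤ L) : 0 < korovkinMass L := by
  refine Finset.sum_pos (fun l hl => ?_) ⟨1, Finset.mem_Icc.2 ⟨le_rfl, by exact_mod_cast hL⟩⟩
  obtain ⟨h1, h2⟩ := Finset.mem_Icc.1 hl
  have h1' : (1 : ℝ) ≤ l := by exact_mod_cast h1
  have h2' : (l : ℝ) ≤ L := by exact_mod_cast h2
  have hL' : (0 : ℝ) < L + 1 := by positivity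
  have : 0 < korovkinCoeff L l := by
    apply sin_pos_of_pos_of_lt_pi
    · have := pi_pos; positivity
    · rw [mul_div_assoc', div_lt_iff₀ hL', mul_comm]
      exact mul_lt_mul_of_pos_left (by linarith) pi_pos
  positivity

theorem integral_korovkinKernel (L : ℕ) (θ : ℝ) :
    ∫ φ in -π..π, korovkinKernel L (θ - φ) = 2 * π * korovkinMass L := by
  unfold korovkinKernel
  rw [intervalIntegral.integral_finsetSum fun l _ =>
    Continuous.intervalIntegrable (by fun_prop) _ _, korovkinMass, Finset.mul_sum]
  refine Finset.sum_congr rfl fun l hl => ?_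
  rw [intervalIntegral.integral_finsetSum fun l _ =>
    Continuous.intervalIntegrable (by fun_prop) _ _, Finset.sum_eq_single l]
  · rw [intervalIntegral.integral_const_mul, integral_cos_int_mul_sub, if_pos (sub_self l)]
    ring
  · intro m _ hm
    rw [intervalIntegral.integral_const_mul, integral_cos_int_mul_sub,
      if_neg (sub_ne_zero.2 hm.symm), mul_zero]
  · exact fun h => absurd hl h

/-- The factor `cos` shifts one index by ±1. The coefficients `sin (l h)`, `h = π / (L + 1)`, form
an eigenvector of the path on `L` vertices, since `sin ((l+1) h) + sin ((l-1) h) = 2 cos h sin (l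
h)`. -/
theorem integral_cos_mul_korovkinKernel (L : ℕ) (θ : ℝ) :
    ∫ φ in -π..π, cos (θ - φ) * korovkinKernel L (θ - φ) =
      2 * π * korovkinMass L * cos (π / (L + 1)) := by
  have hprod : ∀ l m : ℤ, ∫ φ in -π..π, cos (θ - φ) *
      (korovkinCoeff L l * korovkinCoeff L m * cos ((l - m : ℤ) * (θ - φ))) =
      π * korovkinCoeff L l * ((if m = l + 1 then korovkinCoeff L m else 0) +
        (if m = l - 1 then korovkinCoeff L m else 0)) := by
    intro l m
    have h : ∀ φ, cos (θ - φ) *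
        (korovkinCoeff L l * korovkinCoeff L m * cos ((l - m : ℤ) * (θ - φ))) =
        (korovkinCoeff L l * korovkinCoeff L m / 2) *
          (cos ((l - m + 1 : ℤ) * (θ - φ)) + cos ((l - m - 1 : ℤ) * (θ - φ))) := by
      intro φ
      have e1 : ((l - m + 1 : ℤ) : ℝ) * (θ - φ) = (l - m : ℤ) * (θ - φ) + (θ - φ) := by
        push_cast; ring
      have e2 : ((l - m - 1 : ℤ) : ℝ) * (θ - φ) = (l - m : ℤ) * (θ - φ) - (θ - φ) := by
        push_cast; ring
      rw [e1, e2, cos_add _ (θ - φ), cos_sub _ (θ - φ)]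
      ring
    simp only [h]
    rw [intervalIntegral.integral_const_mul, intervalIntegral.integral_add
      (Continuous.intervalIntegrable (by fun_prop) _ _)
      (Continuous.intervalIntegrable (by fun_prop) _ _), integral_cos_int_mul_sub,
      integral_cos_int_mul_sub]
    by_cases h1 : m = l + 1
    · subst h1
      simp [show ¬ (l + 1 = l - 1) by omega]
      ring_nf
    · by_cases h2 : m = l - 1
      · subst h2
        simp [show ¬ (l - 1 = l + 1) by omega]
        ring
      · simp [h1, h2, show ¬ (l - m + 1 = 0) by omega, show ¬ (l - m - 1 = 0) by omega]
  -- The coefficients vanish at the two indices next to the range, 0 and `L + 1`, so the shifted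
  -- sums need no boundary correction.
  have hz : ∀ l : ℤ, l ∉ Finset.Icc (1 : ℤ) L → -1 < l → l < L + 2 → korovkinCoeff L l = 0 := by
    intro l hl h0 h1
    have : l = 0 ∨ l = L + 1 := by
      simp only [Finset.mem_Icc, not_and_or, not_le] at hl
      omega
    rcases this with rfl | rfl
    · simp [korovkinCoeff]
    · have hL' : (L + 1 : ℝ) ≠ 0 := by positivity
      simp only [korovkinCoeff]
      push_cast
      rw [mul_div_cancel₀ _ hL', sin_pi]
  unfold korovkinKernel
  simp only [Finset.mul_sum]
  rw [intervalIntegral.integral_finsetSum fun l _ =>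
    Continuous.intervalIntegrable (by fun_prop) _ _, korovkinMass, Finset.mul_sum, Finset.sum_mul]
  refine Finset.sum_congr rfl fun l hl => ?_
  have hl' := Finset.mem_Icc.1 hl
  rw [intervalIntegral.integral_finsetSum fun l _ =>
    Continuous.intervalIntegrable (by fun_prop) _ _]
  simp only [hprod]
  rw [← Finset.mul_sum, Finset.sum_add_distrib, Finset.sum_ite_eq', Finset.sum_ite_eq']
  have e1 : (if l + 1 ∈ Finset.Icc (1 : ℤ) L then korovkinCoeff L (l + 1) else 0) =
      korovkinCoeff L (l + 1) := by
    split_ifs with h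
    · rfl
    · exact (hz _ h (by omega) (by omega)).symm
  have e2 : (if l - 1 ∈ Finset.Icc (1 : ℤ) L then korovkinCoeff L (l - 1) else 0) =
      korovkinCoeff L (l - 1) := by
    split_ifs with h
    · rfl
    · exact (hz _ h (by omega) (by omega)).symm
  rw [e1, e2]
  simp only [korovkinCoeff]
  push_cast
  rw [add_mul, sub_mul, one_mul, sin_add, sin_sub]
  ring

/-- The integrand is odd. Thus the convolution of `f ∘ cos` with the kernel has no sine part and is
a polynomial in `cos θ`. -/
theorem integral_comp_cos_mul_sin (f : ℝ → ℝ) (n : ℤ) :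
    ∫ φ in -π..π, f (cos φ) * sin (n * φ) = 0 := by
  have h := intervalIntegral.integral_comp_neg (a := -π) (b := π)
    (fun φ => f (cos φ) * sin (n * φ))
  simp only [cos_neg, mul_neg, sin_neg, neg_neg, intervalIntegral.integral_neg] at h
  linarith

/-- **Jackson's theorem** for Lipschitz functions on `[-1, 1]`. -/
theorem exists_polynomial_near_of_lipschitz (f : ℝ → ℝ) (hf : LipschitzWith 1 f) (L : ℕ)
    (hL : 1 ≤ L) : ∃ p : ℝ[X], p.natDegree < L ∧
      ∀ x ∈ Set.Icc (-1 : ℝ) 1, |f x - p.eval x| ≤ π / (L + 1) := by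
  have hS := korovkinMass_pos L hL
  have hfc := hf.continuous
  have hK := continuous_korovkinKernel L
  set S := korovkinMass L with hSdef
  let c : ℤ → ℝ := fun n => ∫ φ in -π..π, f (cos φ) * cos (n * φ)
  -- At `cos θ` this polynomial is the convolution of `f ∘ cos` with the normalized kernel. Its
  -- degree is at most the largest `|l - m|`, that is `L - 1`.
  refine ⟨C (2 * π * S)⁻¹ * ∑ l ∈ Finset.Icc (1 : ℤ) L, ∑ m ∈ Finset.Icc (1 : ℤ) L,
    C (korovkinCoeff L l * korovkinCoeff L m * c (l - m)) * Chebyshev.T ℝ (l - m), ?_, ?_⟩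
  · refine lt_of_le_of_lt (natDegree_C_mul_le _ _) ?_
    refine lt_of_le_of_lt (natDegree_sum_le_of_forall_le (n := L - 1) _ _ fun l hl =>
      natDegree_sum_le_of_forall_le _ _ fun m hm => (natDegree_C_mul_le _ _).trans ?_) (by omega)
    rw [Chebyshev.natDegree_T]
    have h1 := Finset.mem_Icc.1 hl
    have h2 := Finset.mem_Icc.1 hm
    omega
  · intro x hx
    obtain ⟨θ, rfl⟩ : ∃ θ, cos θ = x := ⟨arccos x, cos_arccos hx.1 hx.2⟩
    have hconv : ∫ φ in -π..π, f (cos φ) * korovkinKernel L (θ - φ) =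
        ∑ l ∈ Finset.Icc (1 : ℤ) L, ∑ m ∈ Finset.Icc (1 : ℤ) L,
          korovkinCoeff L l * korovkinCoeff L m * c (l - m) * cos ((l - m : ℤ) * θ) := by
      unfold korovkinKernel
      simp only [Finset.mul_sum]
      rw [intervalIntegral.integral_finsetSum fun l _ =>
        Continuous.intervalIntegrable (by fun_prop) _ _]
      refine Finset.sum_congr rfl fun l hl => ?_
      rw [intervalIntegral.integral_finsetSum fun l _ =>
        Continuous.intervalIntegrable (by fun_prop) _ _]
      refine Finset.sum_congr rfl fun m hm => ?_
      have h : ∀ φ, f (cos φ) *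
          (korovkinCoeff L l * korovkinCoeff L m * cos ((l - m : ℤ) * (θ - φ))) =
          (korovkinCoeff L l * korovkinCoeff L m * cos ((l - m : ℤ) * θ)) *
            (f (cos φ) * cos ((l - m : ℤ) * φ)) +
          (korovkinCoeff L l * korovkinCoeff L m * sin ((l - m : ℤ) * θ)) *
            (f (cos φ) * sin ((l - m : ℤ) * φ)) := by
        intro φ
        rw [mul_sub, cos_sub]
        ring
      simp only [h]
      rw [intervalIntegral.integral_add (Continuous.intervalIntegrable (by fun_prop) _ _)
        (Continuous.intervalIntegrable (by fun_prop) _ _), intervalIntegral.integral_const_mul,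
        intervalIntegral.integral_const_mul, integral_comp_cos_mul_sin]
      simp only [c]
      ring
    have heval : 2 * π * S * (f (cos θ) - (C (2 * π * S)⁻¹ * ∑ l ∈ Finset.Icc (1 : ℤ) L,
        ∑ m ∈ Finset.Icc (1 : ℤ) L, C (korovkinCoeff L l * korovkinCoeff L m * c (l - m)) *
          Chebyshev.T ℝ (l - m)).eval (cos θ)) =
        ∫ φ in -π..π, (f (cos θ) - f (cos φ)) * korovkinKernel L (θ - φ) := by
      simp only [sub_mul]
      rw [intervalIntegral.integral_sub (Continuous.intervalIntegrable (by fun_prop) _ _)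
        (Continuous.intervalIntegrable (by fun_prop) _ _), intervalIntegral.integral_const_mul,
        integral_korovkinKernel, hconv]
      simp only [eval_mul, eval_C, eval_finsetSum, Chebyshev.T_real_cos]
      rw [mul_sub, ← mul_assoc, mul_inv_cancel₀ (by have := pi_pos; positivity), one_mul, hSdef]
      ring
    have hδ : 0 < π / (L + 1) := by have := pi_pos; positivity
    set δ := π / (L + 1) with hδdef
    have hpt : ∀ φ, |(f (cos θ) - f (cos φ)) * korovkinKernel L (θ - φ)| ≤
        (δ / 2 + δ⁻¹) * korovkinKernel L (θ - φ) -
          δ⁻¹ * (cos (θ - φ) * korovkinKernel L (θ - φ)) := by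
      intro φ
      have h1 : |f (cos θ) - f (cos φ)| ≤ |cos θ - cos φ| := by
        simpa [Real.dist_eq] using hf.dist_le_mul (cos θ) (cos φ)
      have h2 : |cos θ - cos φ| ^ 2 ≤ 2 - 2 * cos (θ - φ) := by
        rw [sq_abs, cos_sub]
        nlinarith [sq_nonneg (sin θ - sin φ), sin_sq_add_cos_sq θ, sin_sq_add_cos_sq φ]
      -- The bound `d ≤ δ / 2 + d² / (2 δ)` trades the absolute value for `1 - cos (θ - φ)`, whose
      -- kernel integral is known. After integration `δ = π / (L + 1)` gives `δ / 2 + (1 - cos δ) /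
      -- δ ≤ δ`.
      have h3 : |cos θ - cos φ| ≤ δ / 2 + δ⁻¹ - δ⁻¹ * cos (θ - φ) := by
        have h4 : 0 ≤ δ⁻¹ * (2 - 2 * cos (θ - φ) - |cos θ - cos φ| ^ 2) :=
          mul_nonneg (inv_nonneg.2 hδ.le) (by linarith)
        have h5 : 0 ≤ δ⁻¹ * (|cos θ - cos φ| - δ) ^ 2 := by positivity
        have h6 : δ⁻¹ * δ = 1 := inv_mul_cancel₀ hδ.ne'
        have h7 : δ⁻¹ * (|cos θ - cos φ| - δ) ^ 2 =
            δ⁻¹ * |cos θ - cos φ| ^ 2 - 2 * |cos θ - cos φ| * (δ⁻¹ * δ) + δ * (δ⁻¹ * δ) := by ring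
        rw [h6] at h7
        linarith
      rw [abs_mul, abs_of_nonneg (korovkinKernel_nonneg L _)]
      calc _ ≤ (δ / 2 + δ⁻¹ - δ⁻¹ * cos (θ - φ)) * korovkinKernel L (θ - φ) :=
            mul_le_mul_of_nonneg_right (h1.trans h3) (korovkinKernel_nonneg L _)
        _ = _ := by ring
    have hbound : |∫ φ in -π..π, (f (cos θ) - f (cos φ)) * korovkinKernel L (θ - φ)| ≤
        2 * π * S * δ := by
      refine (intervalIntegral.abs_integral_le_integral_abs (by linarith [pi_pos])).trans ?_
      refine (intervalIntegral.integral_mono_on (by linarith [pi_pos])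
        (Continuous.intervalIntegrable (by fun_prop) _ _)
        (Continuous.intervalIntegrable (by fun_prop) _ _) fun φ _ => hpt φ).trans ?_
      rw [intervalIntegral.integral_sub (Continuous.intervalIntegrable (by fun_prop) _ _)
        (Continuous.intervalIntegrable (by fun_prop) _ _), intervalIntegral.integral_const_mul,
        intervalIntegral.integral_const_mul, integral_korovkinKernel,
        integral_cos_mul_korovkinKernel, ← hδdef, ← hSdef]
      have h8 : δ⁻¹ * (1 - cos δ) ≤ δ⁻¹ * (δ ^ 2 / 2) :=
        mul_le_mul_of_nonneg_left (by linarith [one_sub_sq_div_two_le_cos (x := δ)])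
          (inv_nonneg.2 hδ.le)
      have h9 : δ⁻¹ * (δ ^ 2 / 2) = δ / 2 := by field_simp
      have h10 : 0 < 2 * π * S := by have := pi_pos; positivity
      nlinarith
    rw [← heval, abs_mul, abs_of_pos (by have := pi_pos; positivity)] at hbound
    exact le_of_mul_le_mul_left hbound (by have := pi_pos; positivity)

end Jackson

/-! ### Wasserstein error of a positive quadrature rule -/

section Quadrature
open Polynomial

theorem exists_polynomial_near_of_lipschitz_Icc (f : ℝ → ℝ) (hf : LipschitzWith 1 f) (L : ℕ)
    (hL : 1 ≤ L) (a b : ℝ) (hab : a ≤ b) : ∃ p : ℝ[X], p.natDegree < L ∧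
      ∀ x ∈ Set.Icc a b, |f x - p.eval x| ≤ (b - a) / 2 * (Real.pi / (L + 1)) := by
  rcases hab.eq_or_lt with rfl | hab
  · refine ⟨C (f a), by rw [natDegree_C]; omega, fun x hx => ?_⟩
    rw [le_antisymm hx.2 hx.1]
    simp
  set r := (b - a) / 2 with hr
  set c := (a + b) / 2 with hc
  have hr0 : 0 < r := by rw [hr]; linarith
  obtain ⟨p, hp, hpx⟩ := exists_polynomial_near_of_lipschitz (fun y => r⁻¹ * f (c + r * y))
    (LipschitzWith.of_dist_le_mul fun x y => by
      have := hf.dist_le_mul (c + r * x) (c + r * y)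
      rw [Real.dist_eq] at this ⊢
      rw [← mul_sub, abs_mul, abs_of_pos (inv_pos.2 hr0), inv_mul_le_iff₀ hr0]
      refine this.trans (le_of_eq ?_)
      rw [Real.dist_eq, Real.dist_eq, add_sub_add_left_eq_sub, ← mul_sub, abs_mul, abs_of_pos hr0]
      simp) L hL
  refine ⟨C r * p.comp (C r⁻¹ * (X - C c)), ?_, fun x hx => ?_⟩
  · refine ((natDegree_C_mul_le _ _).trans natDegree_comp_le).trans_lt ?_
    refine lt_of_le_of_lt (Nat.mul_le_mul_left _ ((natDegree_C_mul_le _ _).trans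
      (natDegree_X_sub_C_le c))) ?_
    simpa using hp
  · have hy : r⁻¹ * (x - c) ∈ Set.Icc (-1 : ℝ) 1 := by
      obtain ⟨h1, h2⟩ := hx
      constructor
      · rw [← div_eq_inv_mul, le_div_iff₀ hr0]; linarith
      · rw [← div_eq_inv_mul, div_le_iff₀ hr0]; linarith
    have h := hpx _ hy
    rw [mul_inv_cancel_left₀ hr0.ne', add_sub_cancel] at h
    have h2 : f x - (C r * p.comp (C r⁻¹ * (X - C c))).eval x =
        r * (r⁻¹ * f x - p.eval (r⁻¹ * (x - c))) := by
      rw [mul_sub r, mul_inv_cancel_left₀ hr0.ne']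
      simp
    rw [h2, abs_mul, abs_of_pos hr0]
    exact mul_le_mul_of_nonneg_left h hr0.le

/-- The distribution function of a finite combination of point masses. -/
noncomputable def stepFun {ι : Type*} [Fintype ι] (w x : ι → ℝ) (s : ℝ) : ℝ :=
  ∑ i, w i * if x i ≤ s then 1 else 0

theorem measurable_stepFun {ι : Type*} [Fintype ι] (w x : ι → ℝ) : Measurable (stepFun w x) :=
  Finset.measurable_sum _ fun _ _ => measurable_const.mul
    (Measurable.ite measurableSet_Ici measurable_const measurable_const)

theorem stepFun_of_lt {ι : Type*} [Fintype ι] (w x : ι → ℝ) (a s : ℝ)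
    (hx : ∀ i, w i ≠ 0 → a ≤ x i) (hs : s < a) : stepFun w x s = 0 := by
  refine Finset.sum_eq_zero fun i _ => ?_
  by_cases h : w i = 0
  · simp [h]
  · rw [if_neg (not_le.2 (hs.trans_le (hx i h))), mul_zero]

theorem stepFun_of_le {ι : Type*} [Fintype ι] (w x : ι → ℝ) (b s : ℝ)
    (hx : ∀ i, w i ≠ 0 → x i ≤ b) (hs : b ≤ s) : stepFun w x s = ∑ i, w i := by
  refine Finset.sum_congr rfl fun i _ => ?_
  by_cases h : w i = 0
  · simp [h]
  · rw [if_pos ((hx i h).trans hs), mul_one]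

/-- Each atom contributes the integral of `σ` over `[x i, b)`. In effect this is integration by
parts, turning an integral of distribution functions into one of an antiderivative of `σ`. -/
theorem setIntegral_mul_stepFun {ι : Type*} [Fintype ι] (w x : ι → ℝ) (a b : ℝ)
    (hx : ∀ i, w i ≠ 0 → x i ∈ Set.Icc a b) (σ : ℝ → ℝ) (hσ : ∀ c d, IntervalIntegrable σ volume c d) :
    IntegrableOn (fun s => σ s * stepFun w x s) (Set.Ico a b) ∧
    ∫ s in Set.Ico a b, σ s * stepFun w x s =
      ∑ i, w i * ((∫ s in a..b, σ s) - ∫ s in a..(x i), σ s) := by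
  have hterm : ∀ i, IntegrableOn (fun s => w i * (Set.Ici (x i)).indicator σ s) (Set.Ico a b) ∧
      ∫ s in Set.Ico a b, w i * (Set.Ici (x i)).indicator σ s =
        w i * ((∫ s in a..b, σ s) - ∫ s in a..(x i), σ s) := by
    intro i
    by_cases h : w i = 0
    · simp [h]
    obtain ⟨h1, h2⟩ := hx i h
    have hI : IntegrableOn σ (Set.Ico a b) := by
      rw [integrableOn_Ico_iff_integrableOn_Ioo, ← integrableOn_Ioc_iff_integrableOn_Ioo]
      exact (hσ a b).1
    refine ⟨(hI.indicator measurableSet_Ici).const_mul _, ?_⟩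
    rw [integral_const_mul, setIntegral_indicator measurableSet_Ici,
      intervalIntegral.integral_interval_sub_left (hσ _ _) (hσ _ _),
      intervalIntegral.integral_of_le h2, ← integral_Ico_eq_integral_Ioc]
    congr 3
    ext s
    simp only [Set.mem_inter_iff, Set.mem_Ico, Set.mem_Ici]
    exact ⟨fun hs => ⟨hs.2, hs.1.2⟩, fun hs => ⟨⟨h1.trans hs.1, hs.2⟩, hs.1⟩⟩
  have heq : (fun s => σ s * stepFun w x s) =
      fun s => ∑ i, w i * (Set.Ici (x i)).indicator σ s := by
    funext s
    rw [stepFun, Finset.mul_sum]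
    refine Finset.sum_congr rfl fun i _ => ?_
    by_cases h : x i ≤ s
    · simp [Set.indicator, h]; ring
    · simp [Set.indicator, h]
  rw [heq]
  exact ⟨integrable_finsetSum _ fun i _ => (hterm i).1, by
    rw [integral_finsetSum _ fun i _ => (hterm i).1]
    exact Finset.sum_congr rfl fun i _ => (hterm i).2⟩

/-- The easy half of Kantorovich–Rubinstein duality for finite combinations of point masses. -/
theorem wasserstein_stepFun_le {ι κ : Type*} [Fintype ι] [Fintype κ] (w x : ι → ℝ) (w' y : κ → ℝ)
    (a b D : ℝ) (hx : ∀ i, w i ≠ 0 → x i ∈ Set.Icc a b) (hy : ∀ j, w' j ≠ 0 → y j ∈ Set.Icc a b)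
    (hw : ∑ i, w i = ∑ j, w' j)
    (hD : ∀ f : ℝ → ℝ, LipschitzWith 1 f → |∑ i, w i * f (x i) - ∑ j, w' j * f (y j)| ≤ D) :
    wasserstein (stepFun w x) (stepFun w' y) ≤ ENNReal.ofReal D := by
  set h : ℝ → ℝ := fun s => stepFun w x s - stepFun w' y s with hh
  have hmeas : Measurable h := (measurable_stepFun w x).sub (measurable_stepFun w' y)
  have hsupp : ∀ s, s ∉ Set.Ico a b → h s = 0 := by
    intro s hs
    simp only [Set.mem_Ico, not_and_or, not_le, not_lt] at hs
    rcases hs with hs | hs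
    · rw [hh]
      simp only
      rw [stepFun_of_lt w x a s (fun i hi => (hx i hi).1) hs,
        stepFun_of_lt w' y a s (fun i hi => (hy i hi).1) hs, sub_zero]
    · rw [hh]
      simp only
      rw [stepFun_of_le w x b s (fun i hi => (hx i hi).2) hs,
        stepFun_of_le w' y b s (fun i hi => (hy i hi).2) hs, hw, sub_self]
  -- The sign of the difference. Its antiderivative is 1-Lipschitz and is the test function that
  -- realizes the `L¹` distance.
  let σ : ℝ → ℝ := fun s => if 0 ≤ h s then 1 else -1
  have hσm : Measurable σ :=
    Measurable.ite (measurableSet_le measurable_const hmeas) measurable_const measurable_const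
  have hσ1 : ∀ s, ‖σ s‖ ≤ 1 := by
    intro s
    simp only [σ]
    split_ifs <;> simp
  have hσi : ∀ c d, IntervalIntegrable σ volume c d := fun c d =>
    (intervalIntegrable_const (c := (1 : ℝ))).mono_fun hσm.aestronglyMeasurable
      (Filter.Eventually.of_forall fun s => by simpa using hσ1 s)
  have hσh : ∀ s, |h s| = σ s * h s := by
    intro s
    simp only [σ]
    split_ifs with h0
    · rw [abs_of_nonneg h0, one_mul]
    · rw [abs_of_neg (not_le.1 h0), neg_one_mul]
  have hF := setIntegral_mul_stepFun w x a b hx σ hσi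
  have hG := setIntegral_mul_stepFun w' y a b hy σ hσi
  have habs : (fun s => |h s|) = fun s => σ s * stepFun w x s - σ s * stepFun w' y s := by
    funext s
    rw [hσh, ← mul_sub]
  have hint : IntegrableOn (fun s => |h s|) (Set.Ico a b) := by
    rw [habs]; exact hF.1.sub hG.1
  have hW : wasserstein (stepFun w x) (stepFun w' y) =
      ENNReal.ofReal (∫ s in Set.Ico a b, |h s|) := by
    rw [ofReal_integral_eq_lintegral_ofReal hint (Filter.Eventually.of_forall fun s => abs_nonneg _),
      ← lintegral_indicator measurableSet_Ico, wasserstein]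
    refine lintegral_congr fun s => ?_
    by_cases hs : s ∈ Set.Ico a b
    · rw [Set.indicator_of_mem hs]
    · rw [Set.indicator_of_notMem hs]
      change ENNReal.ofReal |h s| = 0
      rw [hsupp s hs]
      simp
  rw [hW]
  refine ENNReal.ofReal_le_ofReal ?_
  rw [habs, integral_sub hF.1 hG.1, hF.2, hG.2]
  have hlip : LipschitzWith 1 fun z => ∫ s in a..z, σ s := by
    refine LipschitzWith.of_dist_le_mul fun z z' => ?_
    rw [Real.dist_eq, intervalIntegral.integral_interval_sub_left (hσi _ _) (hσi _ _)]
    simpa [Real.dist_eq] using intervalIntegral.norm_integral_le_of_norm_le_const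
      (a := z') (b := z) fun s _ => hσ1 s
  refine le_trans ?_ (hD _ hlip)
  simp only [mul_sub, Finset.sum_sub_distrib, ← Finset.sum_mul, hw]
  rw [abs_sub_comm]
  refine le_trans (le_of_eq ?_) (le_abs_self _)
  ring

/-- If `q` were negative at a charged node, test exactness on `q P²`, where `P` vanishes at all
other nodes: the degree is at most `1 + 2 (k - 1) < 2k`, the rule gives a negative value and the
measure a nonnegative one. With `q = X - a` and `q = b - X` this confines the charged nodes to `[a,
b]`. -/
theorem eval_node_nonneg {ι : Type*} [Fintype ι] {k : ℕ} (w x : ι → ℝ)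
    (w' y : Fin k → ℝ) (hw : ∀ i, 0 ≤ w i) (hw' : ∀ j, 0 ≤ w' j)
    (hmom : ∀ p : ℝ[X], p.natDegree < 2 * k →
      ∑ j, w' j * p.eval (y j) = ∑ i, w i * p.eval (x i))
    (q : ℝ[X]) (hq : q.natDegree ≤ 1) (hqx : ∀ i, 0 ≤ q.eval (x i)) (j : Fin k)
    (hj : w' j ≠ 0) : 0 ≤ q.eval (y j) := by
  classical
  by_contra! hneg
  -- Nodes may coincide; the image keeps each value once, so removing `y j` removes all its copies.
  set s := (Finset.univ.image y).erase (y j) with hs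
  have hcard : s.card + 1 ≤ k := by
    rw [hs, Finset.card_erase_add_one (Finset.mem_image_of_mem y (Finset.mem_univ j))]
    exact Finset.card_image_le.trans (by simp)
  set P : ℝ[X] := ∏ z ∈ s, (X - C z) with hP
  have hdeg : (q * P ^ 2).natDegree < 2 * k := by
    have h1 : P.natDegree = s.card := by
      rw [hP, natDegree_prod_of_monic _ _ fun z _ => monic_X_sub_C z]
      simp
    have h2 := natDegree_mul_le (p := q) (q := P ^ 2)
    have h3 := natDegree_pow_le (p := P) (n := 2)
    omega
  have h := hmom _ hdeg
  have hpos : 0 ≤ ∑ i, w i * (q * P ^ 2).eval (x i) := Finset.sum_nonneg fun i _ => by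
    rw [eval_mul, eval_pow]
    exact mul_nonneg (hw i) (mul_nonneg (hqx i) (sq_nonneg _))
  have hle : ∀ i, w' i * (q * P ^ 2).eval (y i) ≤ 0 := by
    intro i
    by_cases hi : y i = y j
    · rw [hi, eval_mul, eval_pow]
      exact mul_nonpos_of_nonneg_of_nonpos (hw' i)
        (mul_nonpos_of_nonpos_of_nonneg hneg.le (sq_nonneg _))
    · have : P.eval (y i) = 0 := by
        rw [hP, eval_prod]
        exact Finset.prod_eq_zero (i := y i) (by simp [hs, hi]) (by simp)
      simp [this]
  have hlt : w' j * (q * P ^ 2).eval (y j) < 0 := by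
    rw [eval_mul, eval_pow]
    refine mul_neg_of_pos_of_neg ((hw' j).lt_of_ne' hj) (mul_neg_of_neg_of_pos hneg ?_)
    have : P.eval (y j) ≠ 0 := by
      rw [hP, eval_prod]
      refine Finset.prod_ne_zero_iff.2 fun z hz => ?_
      rw [eval_sub, eval_X, eval_C, sub_ne_zero]
      exact (Finset.ne_of_mem_erase hz).symm
    positivity
  have : ∑ i, w' i * (q * P ^ 2).eval (y i) < 0 :=
    (Finset.sum_lt_sum (fun i _ => hle i) ⟨j, Finset.mem_univ j, hlt⟩).trans_eq (by simp)
  linarith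

theorem abs_sum_sub_sum_le {ι : Type*} [Fintype ι] (w x : ι → ℝ) (hw : ∀ i, 0 ≤ w i)
    (hw1 : ∑ i, w i = 1) (f g : ℝ → ℝ) (ε : ℝ) (h : ∀ i, w i ≠ 0 → |f (x i) - g (x i)| ≤ ε) :
    |∑ i, w i * f (x i) - ∑ i, w i * g (x i)| ≤ ε := by
  rw [← Finset.sum_sub_distrib]
  refine (Finset.abs_sum_le_sum_abs _ _).trans ?_
  calc _ ≤ ∑ i, w i * ε := Finset.sum_le_sum fun i _ => by
        by_cases hi : w i = 0
        · simp [hi]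
        · rw [← mul_sub, abs_mul, abs_of_nonneg (hw i)]
          exact mul_le_mul_of_nonneg_left (h i hi) (hw i)
    _ = ε := by rw [← Finset.sum_mul, hw1, one_mul]

/-- A `k`-point rule that is exact for polynomials of degree less than `2 k` is close to its
measure in Wasserstein distance. -/
theorem wasserstein_quadrature_le {ι : Type*} [Fintype ι] {k : ℕ} (hk : 1 ≤ k) (w x : ι → ℝ)
    (w' y : Fin k → ℝ) (hw : ∀ i, 0 ≤ w i) (hw' : ∀ j, 0 ≤ w' j) (hw1 : ∑ i, w i = 1)
    (a b : ℝ) (hab : a ≤ b) (hx : ∀ i, x i ∈ Set.Icc a b)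
    (hmom : ∀ p : ℝ[X], p.natDegree < 2 * k →
      ∑ j, w' j * p.eval (y j) = ∑ i, w i * p.eval (x i)) :
    wasserstein (stepFun w x) (stepFun w' y) ≤
      ENNReal.ofReal ((b - a) * (Real.pi / (2 * k + 1))) := by
  have hy : ∀ j, w' j ≠ 0 → y j ∈ Set.Icc a b := by
    intro j hj
    have h1 := eval_node_nonneg w x w' y hw hw' hmom (X - C a) (natDegree_X_sub_C_le a)
      (fun i => by simpa using (hx i).1) j hj
    have h2 := eval_node_nonneg w x w' y hw hw' hmom (C b - X)
      ((natDegree_sub_le _ _).trans (by simp)) (fun i => by simpa using (hx i).2) j hj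
    simp only [eval_sub, eval_X, eval_C, sub_nonneg] at h1 h2
    exact ⟨h1, h2⟩
  have hw1' : ∑ j, w' j = 1 := by
    have := hmom 1 (by simp; omega)
    simpa [hw1] using this
  refine wasserstein_stepFun_le w x w' y a b _ (fun i _ => hx i) hy (hw1.trans hw1'.symm)
    fun f hf => ?_
  -- With `L = 2k` the polynomial is integrated exactly. The approximation error, with factor `(b -
  -- a) / 2`, is paid once for the measure and once for the rule.
  obtain ⟨p, hp, hpx⟩ := exists_polynomial_near_of_lipschitz_Icc f hf (2 * k) (by omega) a b hab
  set ε := (b - a) / 2 * (Real.pi / ((2 * k : ℕ) + 1)) with hε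
  have k1 := abs_sum_sub_sum_le w x hw hw1 f p.eval ε fun i _ => hpx _ (hx i)
  have k2 := abs_sum_sub_sum_le w' y hw' hw1' f p.eval ε fun j hj => hpx _ (hy j hj)
  rw [hmom p hp] at k2
  have hε2 : (b - a) * (Real.pi / (2 * k + 1)) = ε + ε := by
    rw [hε]; push_cast; ring
  rw [hε2, abs_le]
  rw [abs_le] at k1 k2
  constructor <;> linarith

end Quadrature

theorem wasserstein_lanczosQuadrature_le {n : ℕ} (A : Matrix (Fin n) (Fin n) ℝ)
    (hA : A.IsHermitian) (reorth : Bool) (v : EuclideanSpace ℝ (Fin n)) (hv : ‖v‖ = 1)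
    (k : ℕ) (hk : 1 ≤ k) :
    wasserstein (weightedCesm hA v) (lanczosQuadrature A reorth v k) ≤
      ENNReal.ofReal (spectralWidth hA * (Real.pi / (2 * k + 1))) := by
  have h1 : weightedCesm hA v = stepFun (specWeight hA v) hA.eigenvalues :=
    funext fun x => weightedCesm_eq_sum hA v x
  have h2 : lanczosQuadrature A reorth v k = stepFun
      (specWeight (lanczosT_isHermitian A reorth v k) (e1 k))
      (lanczosT_isHermitian A reorth v k).eigenvalues :=
    funext fun x => weightedCesm_eq_sum _ _ x
  have hsum : ∑ i, specWeight hA v i = 1 := by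
    rw [sum_specWeight]
    have := EuclideanSpace.inner_eq_star_dotProduct v v
    rw [real_inner_self_eq_norm_sq, hv, star_trivial] at this
    rw [← this]; norm_num
  have hne : Nonempty (Fin n) := by
    by_contra h
    rw [not_nonempty_iff] at h
    simp at hsum
  have hx : ∀ i, hA.eigenvalues i ∈ Set.Icc (⨅ i, hA.eigenvalues i) (⨆ i, hA.eigenvalues i) :=
    fun i => ⟨ciInf_le (Set.finite_range _).bddBelow i, le_ciSup (Set.finite_range _).bddAbove i⟩
  have hle : (⨅ i, hA.eigenvalues i) ≤ ⨆ i, hA.eigenvalues i :=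
    (hx hne.some).1.trans (hx hne.some).2
  rw [h1, h2, spectralWidth, abs_of_nonneg (sub_nonneg.2 hle)]
  exact wasserstein_quadrature_le hk _ _ _ _ (specWeight_nonneg hA v) (specWeight_nonneg _ _)
    hsum _ _ hle hx (lanczosT_polynomial_moments A reorth v hA hv k)

/-! ### Linear changes of variables on the unit sphere -/

section Sphere

variable {E : Type*} [NormedAddCommGroup E] [NormedSpace ℝ E] [MeasurableSpace E] [BorelSpace E]
  [FiniteDimensional ℝ E] [Nontrivial E] (μ : Measure E) [μ.IsAddHaarMeasure]

theorem lintegral_eq_lintegral_toSphere (F : E → ENNReal) (hF : Measurable F) :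
    ∫⁻ x, F x ∂μ = ∫⁻ v, ∫⁻ r, F (r.1 • (v : E))
      ∂(Measure.volumeIoiPow (Module.finrank ℝ E - 1)) ∂μ.toSphere := by
  have h1 : ∫⁻ x, F x ∂μ = ∫⁻ x : ({0}ᶜ : Set E), F x ∂(μ.comap (↑)) := by
    rw [lintegral_subtype_comap (measurableSet_singleton (0 : E)).compl,
      restrict_compl_singleton]
  have h2 : ∫⁻ x : ({0}ᶜ : Set E), F x ∂(μ.comap (↑)) =
      ∫⁻ p : Metric.sphere (0 : E) 1 × Set.Ioi (0 : ℝ), F (p.2.1 • (p.1 : E))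
        ∂(μ.toSphere.prod (Measure.volumeIoiPow (Module.finrank ℝ E - 1))) := by
    have h := (μ.measurePreserving_homeomorphUnitSphereProd).lintegral_comp_emb
      (Homeomorph.measurableEmbedding _) (fun p => F (p.2.1 • (p.1 : E)))
    rw [← h]
    refine lintegral_congr fun x => ?_
    have := congrArg Subtype.val ((homeomorphUnitSphereProd E).symm_apply_apply x)
    exact congrArg F this.symm
  rw [h1, h2, lintegral_prod]
  exact (hF.comp (by fun_prop)).aemeasurable

/-- In polar coordinates `g ∘ L` does not depend on the radius, and the condition `r ‖L v‖ < 1`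
leaves the integral of `r ^ (d - 1)` from 0 to `‖L v‖⁻¹`. -/
theorem lintegral_cone (L : E →ₗ[ℝ] E) (hL : ∀ x, x ≠ 0 → L x ≠ 0) (g : E → ENNReal)
    (hg : Measurable g) (hg0 : ∀ (r : ℝ) (x : E), 0 < r → g (r • x) = g x) :
    ∫⁻ x, g (L x) * (Metric.ball (0 : E) 1).indicator 1 (L x) ∂μ =
      ∫⁻ v, g (L v) * ENNReal.ofReal ((‖L v‖⁻¹) ^ (Module.finrank ℝ E) / Module.finrank ℝ E)
        ∂μ.toSphere := by
  have hLm : Measurable L := L.continuous_of_finiteDimensional.measurable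
  have hdim : 0 < Module.finrank ℝ E := Module.finrank_pos
  rw [lintegral_eq_lintegral_toSphere μ
    (fun x => g (L x) * (Metric.ball (0 : E) 1).indicator 1 (L x)) ((hg.comp hLm).mul
    ((measurable_one.indicator Metric.isOpen_ball.measurableSet).comp hLm))]
  refine lintegral_congr fun v => ?_
  have hv : L v ≠ 0 := hL v (by
    intro h
    have h1 : ‖(v : E)‖ = 1 := by simp
    simp [h] at h1)
  have hpos : 0 < ‖L v‖⁻¹ := inv_pos.2 (norm_pos_iff.2 hv)
  have h : ∀ r : Set.Ioi (0 : ℝ), g (L (r.1 • (v : E))) *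
      (Metric.ball (0 : E) 1).indicator 1 (L (r.1 • (v : E))) =
      g (L v) * (Set.Iio (⟨‖L v‖⁻¹, hpos⟩ : Set.Ioi (0 : ℝ))).indicator 1 r := by
    rintro ⟨r, hr⟩
    rw [Set.mem_Ioi] at hr
    simp only [map_smul]
    rw [hg0 r _ hr]
    congr 1
    simp only [Set.indicator, Metric.mem_ball, dist_zero_right, norm_smul, Set.mem_Iio,
      Real.norm_eq_abs, abs_of_pos hr, Pi.one_apply]
    have : (r * ‖L v‖ < 1) ↔ ((⟨r, hr⟩ : Set.Ioi (0 : ℝ)) < ⟨‖L v‖⁻¹, hpos⟩) := by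
      rw [← Subtype.coe_lt_coe, lt_inv_comm₀ hr (norm_pos_iff.2 hv), inv_eq_one_div,
        lt_div_iff₀ hr, mul_comm]
    simp only [this]
  simp only [h]
  rw [lintegral_const_mul _ (measurable_one.indicator measurableSet_Iio),
    lintegral_indicator_one measurableSet_Iio, Measure.volumeIoiPow_apply_Iio,
    Nat.sub_add_cancel hdim]
  congr 3
  rw [Nat.cast_sub hdim]
  simp

/-- The transformation of integrals over the unit sphere under a linear change of variables. -/
theorem lintegral_toSphere_linear (L : E →ₗ[ℝ] E) (hL : LinearMap.det L ≠ 0) (g : E → ENNReal)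
    (hg : Measurable g) (hg0 : ∀ (r : ℝ) (x : E), 0 < r → g (r • x) = g x) :
    ∫⁻ v, g (L v) * ENNReal.ofReal ((‖L v‖⁻¹) ^ (Module.finrank ℝ E)) ∂μ.toSphere =
      ENNReal.ofReal |(LinearMap.det L)⁻¹| * ∫⁻ v, g v ∂μ.toSphere := by
  have hLm : Measurable L := L.continuous_of_finiteDimensional.measurable
  have hLinj : ∀ x, x ≠ 0 → L x ≠ 0 := by
    intro x hx h
    have : L.ker = ⊥ := by
      by_contra hne
      exact hL (LinearMap.det_eq_zero_iff_ker_ne_bot.2 hne)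
    exact hx (LinearMap.ker_eq_bot'.1 this x h)
  have hdim : (0 : ℝ) < Module.finrank ℝ E := by exact_mod_cast Module.finrank_pos
  have h1 := lintegral_cone μ L hLinj g hg hg0
  have h2 := lintegral_cone μ LinearMap.id (fun x hx => hx) g hg hg0
  set d := Module.finrank ℝ E
  have hmeas : Measurable fun y => g y * (Metric.ball (0 : E) 1).indicator 1 y :=
    hg.mul (measurable_one.indicator Metric.isOpen_ball.measurableSet)
  -- The linear change of variables in `E` itself. Reading both sides in polar coordinates, once for
  -- `L` and once for the identity, gives the statement on the sphere.
  have h3 : ∫⁻ x, g (L x) * (Metric.ball (0 : E) 1).indicator 1 (L x) ∂μ =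
      ENNReal.ofReal |(LinearMap.det L)⁻¹| *
        ∫⁻ x, g x * (Metric.ball (0 : E) 1).indicator 1 x ∂μ := by
    rw [← lintegral_map hmeas hLm, Measure.map_linearMap_addHaar_eq_smul_addHaar μ hL,
      lintegral_smul_measure, smul_eq_mul]
  simp only [LinearMap.id_coe, id] at h2
  rw [h1, h2] at h3
  simp only [norm_eq_of_mem_sphere, inv_one, one_pow] at h3
  rw [lintegral_mul_const (f := fun v : Metric.sphere (0 : E) 1 => g v) _
    (hg.comp measurable_subtype_coe)] at h3
  have h4 : ∀ v : Metric.sphere (0 : E) 1, g (L v) * ENNReal.ofReal (‖L v‖⁻¹ ^ d / d) =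
      (g (L v) * ENNReal.ofReal (‖L v‖⁻¹ ^ d)) * ENNReal.ofReal (1 / d) := by
    intro v
    rw [mul_assoc, ← ENNReal.ofReal_mul (by positivity), mul_one_div]
  simp only [h4] at h3
  rw [lintegral_mul_const _ (by fun_prop), ← mul_assoc] at h3
  refine (ENNReal.mul_left_inj ?_ ENNReal.ofReal_ne_top).1 h3
  rw [Ne, ENNReal.ofReal_eq_zero, not_le]
  positivity

end Sphere

/-! ### From Stein's identity to a sub-Gaussian bound -/

section Subgaussian
open Real

variable {Ω : Type*} [MeasurableSpace Ω] (μ : Measure Ω) [IsProbabilityMeasure μ] (X : Ω → ℝ)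

theorem integrable_continuous_comp (hX : Measurable X) (h01 : ∀ ω, X ω ∈ Set.Icc (0 : ℝ) 1)
    (f : ℝ → ℝ) (hf : Continuous f) : Integrable (fun ω => f (X ω)) μ := by
  obtain ⟨C, hC⟩ := isCompact_Icc.exists_bound_of_continuousOn (s := Set.Icc (0 : ℝ) 1)
    hf.continuousOn
  exact Integrable.of_bound (hf.measurable.comp hX).aestronglyMeasurable C
    (Filter.Eventually.of_forall fun ω => hC _ (h01 ω))

/-- The Stein identity of a Beta law with parameters `α`, `N - α` yields a sub-Gaussian bound with
variance proxy `1 / (4 N)`. -/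
theorem mgf_sub_le_of_stein (hX : Measurable X) (h01 : ∀ ω, X ω ∈ Set.Icc (0 : ℝ) 1)
    (N α : ℝ) (hN : 0 < N)
    (hstein : ∀ s, ∫ ω, (N * X ω - α) * exp (s * X ω) ∂μ =
      s * ∫ ω, X ω * (1 - X ω) * exp (s * X ω) ∂μ) (s : ℝ) :
    mgf (fun ω => X ω - α / N) μ s ≤ exp (s ^ 2 / (8 * N)) := by
  have hint := fun f hf => integrable_continuous_comp μ X hX h01 f hf
  have hset : integrableExpSet X μ = Set.univ := by
    ext s
    simp only [integrableExpSet, Set.mem_ofPred_eq, Set.mem_univ, iff_true]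
    exact hint (fun x => exp (s * x)) (by fun_prop)
  have hd : ∀ s, HasDerivAt (mgf X μ) (∫ ω, X ω * exp (s * X ω) ∂μ) s := fun s =>
    hasDerivAt_mgf (by simp [hset])
  -- Nonpositive because `x (1 - x) ≤ 1 / 4`; this is where the variance proxy `1 / (4 N)` comes
  -- from.
  set V : ℝ → ℝ := fun s => (∫ ω, X ω * (1 - X ω) * exp (s * X ω) ∂μ) - mgf X μ s / 4 with hV
  have hVneg : ∀ s, V s ≤ 0 := by
    intro s
    rw [hV, sub_nonpos, mgf, ← integral_div]
    refine integral_mono (hint (fun x => x * (1 - x) * exp (s * x)) (by fun_prop))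
      (hint (fun x => exp (s * x) / 4) (by fun_prop)) fun ω => ?_
    have := exp_pos (s * X ω)
    nlinarith [mul_nonneg this.le (sq_nonneg (X ω - 1 / 2))]
  have hst : ∀ s, (∫ ω, X ω * exp (s * X ω) ∂μ) - (α / N + s / (4 * N)) * mgf X μ s =
      s / N * V s := by
    intro s
    have h1 : ∫ ω, (N * X ω - α) * exp (s * X ω) ∂μ =
        N * (∫ ω, X ω * exp (s * X ω) ∂μ) - α * mgf X μ s := by
      rw [mgf, ← integral_const_mul, ← integral_const_mul, ← integral_sub
        (hint (fun x => N * (x * exp (s * x))) (by fun_prop))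
        (hint (fun x => α * exp (s * x)) (by fun_prop))]
      refine integral_congr_ae (Filter.Eventually.of_forall fun ω => ?_)
      simp only
      ring
    rw [hV]
    simp only
    have h2 := hstein s
    rw [h1] at h2
    generalize (∫ ω, X ω * exp (s * X ω) ∂μ) = I at h2 ⊢
    generalize (∫ ω, X ω * (1 - X ω) * exp (s * X ω) ∂μ) = J at h2 ⊢
    field_simp
    linarith
  -- The moment generating function divided by the Gaussian bound. By `hst` its derivative has the
  -- sign of `s V(s)`, so it is largest at `s = 0`, where it equals 1.
  set ψ : ℝ → ℝ := fun s => exp (-(α / N * s + s ^ 2 / (8 * N))) * mgf X μ s with hψ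
  have hψd : ∀ s, HasDerivAt ψ
      (exp (-(α / N * s + s ^ 2 / (8 * N))) * (s / N * V s)) s := by
    intro s
    have h1 : HasDerivAt (fun s => -(α / N * s + s ^ 2 / (8 * N))) (-(α / N + s / (4 * N))) s := by
      have := (((hasDerivAt_id s).const_mul (α / N)).add
        ((hasDerivAt_pow 2 s).div_const (8 * N))).neg
      refine this.congr_deriv ?_
      field_simp
      ring
    refine (h1.exp.mul (hd s)).congr_deriv ?_
    rw [← hst]
    ring
  have hψ0 : ψ 0 = 1 := by simp [hψ]
  have hψc : Continuous ψ := continuous_iff_continuousAt.2 fun s => (hψd s).continuousAt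
  have hle : ψ s ≤ 1 := by
    rw [← hψ0]
    rcases le_total 0 s with hs | hs
    · refine antitoneOn_of_deriv_nonpos (convex_Icc 0 s) hψc.continuousOn
        (fun x _ => (hψd x).differentiableAt.differentiableWithinAt) (fun x hx => ?_)
        (Set.left_mem_Icc.2 hs) (Set.right_mem_Icc.2 hs) hs
      rw [interior_Icc] at hx
      rw [(hψd x).deriv]
      exact mul_nonpos_of_nonneg_of_nonpos (exp_pos _).le
        (mul_nonpos_of_nonneg_of_nonpos (div_nonneg hx.1.le hN.le) (hVneg x))
    · refine monotoneOn_of_deriv_nonneg (convex_Icc s 0) hψc.continuousOn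
        (fun x _ => (hψd x).differentiableAt.differentiableWithinAt) (fun x hx => ?_)
        (Set.left_mem_Icc.2 hs) (Set.right_mem_Icc.2 hs) hs
      rw [interior_Icc] at hx
      rw [(hψd x).deriv]
      exact mul_nonneg (exp_pos _).le
        (mul_nonneg_of_nonpos_of_nonpos (div_nonpos_of_nonpos_of_nonneg hx.2.le hN.le) (hVneg x))
  have hmgf : mgf (fun ω => X ω - α / N) μ s = exp (-(α / N * s)) * mgf X μ s := by
    rw [mgf, mgf, ← integral_const_mul]
    refine integral_congr_ae (Filter.Eventually.of_forall fun ω => ?_)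
    simp only
    rw [← exp_add]
    ring_nf
  rw [hmgf]
  rw [hψ] at hle
  simp only [neg_add, exp_add] at hle
  have h3 := mul_le_mul_of_nonneg_right hle (exp_pos (s ^ 2 / (8 * N))).le
  rw [one_mul] at h3
  refine le_trans (le_of_eq ?_) h3
  rw [mul_right_comm, mul_assoc (exp (-(α / N * s))), ← exp_add, neg_add_cancel, exp_zero, mul_one]

theorem hasSubgaussianMGF_of_stein (hX : Measurable X) (h01 : ∀ ω, X ω ∈ Set.Icc (0 : ℝ) 1)
    (N α : ℝ) (hN : 0 < N)
    (hstein : ∀ s, ∫ ω, (N * X ω - α) * exp (s * X ω) ∂μ =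
      s * ∫ ω, X ω * (1 - X ω) * exp (s * X ω) ∂μ) :
    HasSubgaussianMGF (fun ω => X ω - α / N) (1 / (4 * N)).toNNReal μ where
  integrable_exp_mul t :=
    integrable_continuous_comp μ X hX h01 (fun x => exp (t * (x - α / N))) (by fun_prop)
  mgf_le s := by
    refine (mgf_sub_le_of_stein μ X hX h01 N α hN hstein s).trans (le_of_eq ?_)
    rw [Real.coe_toNNReal _ (by positivity)]
    congr 1
    field_simp
    ring

/-- Differentiating the transformation identity of a Beta law gives its Stein identity. -/
theorem stein_of_transform (hX : Measurable X) (h01 : ∀ ω, X ω ∈ Set.Icc (0 : ℝ) 1)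
    (N α s : ℝ)
    (htr : ∀ b : ℝ, 0 < b → ∫ ω, exp (s * (b * X ω / (1 + (b - 1) * X ω))) *
      (1 + (b - 1) * X ω) ^ (-N) ∂μ = b ^ (-α) * ∫ ω, exp (s * X ω) ∂μ) :
    ∫ ω, (N * X ω - α) * exp (s * X ω) ∂μ =
      s * ∫ ω, X ω * (1 - X ω) * exp (s * X ω) ∂μ := by
  have hint := fun f hf => integrable_continuous_comp μ X hX h01 f hf
  let G : ℝ → ℝ → ℝ := fun b x => exp (s * (b * x / (1 + (b - 1) * x))) * (1 + (b - 1) * x) ^ (-N)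
  let G' : ℝ → ℝ → ℝ := fun b x =>
    exp (s * (b * x / (1 + (b - 1) * x))) * (s * (x * (1 - x) / (1 + (b - 1) * x) ^ 2)) *
      (1 + (b - 1) * x) ^ (-N) +
    exp (s * (b * x / (1 + (b - 1) * x))) * ((x * (-N)) * (1 + (b - 1) * x) ^ (-N - 1))
  -- Only the derivative at `b = 1` is needed. On this neighbourhood the denominator stays positive,
  -- and compactness supplies the constant dominating the derivative.
  have hD : ∀ b ∈ Set.Icc (1 / 2 : ℝ) (3 / 2), ∀ x ∈ Set.Icc (0 : ℝ) 1, 0 < 1 + (b - 1) * x := by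
    intro b hb x hx
    nlinarith [hb.1, hx.1, hx.2, mul_nonneg (sub_nonneg.2 hb.1) hx.1]
  have hder : ∀ b ∈ Set.Icc (1 / 2 : ℝ) (3 / 2), ∀ x ∈ Set.Icc (0 : ℝ) 1,
      HasDerivAt (fun b => G b x) (G' b x) b := by
    intro b hb x hx
    have h0 := hD b hb x hx
    have h1 : HasDerivAt (fun b : ℝ => 1 + (b - 1) * x) x b := by
      simpa using (((hasDerivAt_id b).sub_const 1).mul_const x).const_add 1
    have h2 : HasDerivAt (fun b : ℝ => s * (b * x / (1 + (b - 1) * x)))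
        (s * (x * (1 - x) / (1 + (b - 1) * x) ^ 2)) b := by
      refine ((((hasDerivAt_id b).mul_const x).div h1 h0.ne').const_mul s).congr_deriv ?_
      simp only [id]
      congr 2
      ring
    refine (h2.exp.mul (h1.rpow_const (p := -N) (Or.inl h0.ne'))).congr_deriv ?_
    simp only [G']
  have hcont : ContinuousOn (fun p : ℝ × ℝ => G' p.1 p.2)
      (Set.Icc (1 / 2 : ℝ) (3 / 2) ×ˢ Set.Icc (0 : ℝ) 1) := by
    have hne : ∀ p ∈ Set.Icc (1 / 2 : ℝ) (3 / 2) ×ˢ Set.Icc (0 : ℝ) 1,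
        1 + (p.1 - 1) * p.2 ≠ 0 := fun p hp => (hD p.1 hp.1 p.2 hp.2).ne'
    have c0 : ContinuousOn (fun p : ℝ × ℝ => 1 + (p.1 - 1) * p.2)
      (Set.Icc (1 / 2 : ℝ) (3 / 2) ×ˢ Set.Icc (0 : ℝ) 1) := by fun_prop
    have c1 : ContinuousOn (fun p : ℝ × ℝ => exp (s * (p.1 * p.2 / (1 + (p.1 - 1) * p.2))))
        (Set.Icc (1 / 2 : ℝ) (3 / 2) ×ˢ Set.Icc (0 : ℝ) 1) :=
      (ContinuousOn.mul (by fun_prop) (ContinuousOn.div (by fun_prop) c0 hne)).rexp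
    have c2 : ∀ q : ℝ, ContinuousOn (fun p : ℝ × ℝ => (1 + (p.1 - 1) * p.2) ^ q)
        (Set.Icc (1 / 2 : ℝ) (3 / 2) ×ˢ Set.Icc (0 : ℝ) 1) := fun q =>
      c0.rpow_const fun p hp => Or.inl (hne p hp)
    have c3 : ContinuousOn (fun p : ℝ × ℝ => s * (p.2 * (1 - p.2) / (1 + (p.1 - 1) * p.2) ^ 2))
        (Set.Icc (1 / 2 : ℝ) (3 / 2) ×ˢ Set.Icc (0 : ℝ) 1) :=
      ContinuousOn.mul (by fun_prop) (ContinuousOn.div (by fun_prop) (c0.pow 2)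
        fun p hp => pow_ne_zero 2 (hne p hp))
    exact ((c1.mul c3).mul (c2 _)).add (c1.mul (ContinuousOn.mul (by fun_prop) (c2 _)))
  obtain ⟨C, hC⟩ := (isCompact_Icc.prod isCompact_Icc).exists_bound_of_continuousOn hcont
  have hmeas : ∀ b, AEStronglyMeasurable (fun ω => G b (X ω)) μ := fun b => by
    refine (Measurable.comp (g := G b) ?_ hX).aestronglyMeasurable
    simp only [G]
    fun_prop
  have h1mem : (1 : ℝ) ∈ Set.Icc (1 / 2 : ℝ) (3 / 2) := by constructor <;> norm_num
  have hG1 : ∀ x, G 1 x = exp (s * x) := fun x => by simp [G]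
  have hG'1 : ∀ x, G' 1 x = exp (s * x) * (s * (x * (1 - x))) - N * x * exp (s * x) := fun x => by
    simp [G']; ring
  have hderiv := (hasDerivAt_integral_of_dominated_loc_of_deriv_le (μ := μ) (x₀ := (1 : ℝ))
    (F := fun b ω => G b (X ω)) (F' := fun b ω => G' b (X ω)) (bound := fun _ => C)
    (s := Set.Icc (1 / 2 : ℝ) (3 / 2)) (Icc_mem_nhds (by norm_num) (by norm_num))
    (Filter.Eventually.of_forall hmeas)
    (by simp only [hG1]; exact hint (fun x => exp (s * x)) (by fun_prop))
    (by
      simp only [hG'1]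
      exact (hint (fun x => exp (s * x) * (s * (x * (1 - x))) - N * x * exp (s * x))
        (by fun_prop)).aestronglyMeasurable)
    (Filter.Eventually.of_forall fun ω b hb => hC (b, X ω) ⟨hb, h01 ω⟩)
    (integrable_const C)
    (Filter.Eventually.of_forall fun ω b hb => hder b hb _ (h01 ω))).2
  have hderiv2 : HasDerivAt (fun b : ℝ => ∫ ω, G b (X ω) ∂μ) (-α * ∫ ω, exp (s * X ω) ∂μ) 1 := by
    have h : HasDerivAt (fun b : ℝ => b ^ (-α) * ∫ ω, exp (s * X ω) ∂μ)
        (-α * ∫ ω, exp (s * X ω) ∂μ) 1 := by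
      refine ((hasDerivAt_rpow_const (x := (1 : ℝ)) (p := -α)
        (Or.inl one_ne_zero)).mul_const _).congr_deriv ?_
      simp
    refine h.congr_of_eventuallyEq ?_
    filter_upwards [lt_mem_nhds (show (0 : ℝ) < 1 by norm_num)] with b hb
    exact htr b hb
  have heq := hderiv.unique hderiv2
  simp only [hG'1] at heq
  rw [integral_sub (hint (fun x => exp (s * x) * (s * (x * (1 - x)))) (by fun_prop))
    (hint (fun x => N * x * exp (s * x)) (by fun_prop))] at heq
  have e1 : ∫ ω, exp (s * X ω) * (s * (X ω * (1 - X ω))) ∂μ =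
      s * ∫ ω, X ω * (1 - X ω) * exp (s * X ω) ∂μ := by
    rw [← integral_const_mul]
    refine integral_congr_ae (Filter.Eventually.of_forall fun ω => ?_)
    simp only
    ring
  have e2 : ∫ ω, (N * X ω - α) * exp (s * X ω) ∂μ =
      (∫ ω, N * X ω * exp (s * X ω) ∂μ) - α * ∫ ω, exp (s * X ω) ∂μ := by
    rw [← integral_const_mul, ← integral_sub (hint (fun x => N * x * exp (s * x)) (by fun_prop))
      (hint (fun x => α * exp (s * x)) (by fun_prop))]
    refine integral_congr_ae (Filter.Eventually.of_forall fun ω => ?_)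
    simp only
    ring
  rw [e1] at heq
  rw [e2]
  linarith

end Subgaussian

/-! ### Concentration of projections of a uniform unit vector -/

section UniformSphere

theorem isProbabilityMeasure_uniformSphere {n : ℕ} (hn : 1 ≤ n) :
    IsProbabilityMeasure (uniformSphere n) := by
  have : NeZero n := ⟨by omega⟩
  refine ⟨?_⟩
  rw [uniformSphere, Measure.smul_apply, smul_eq_mul]
  exact ENNReal.inv_mul_cancel (Measure.measure_univ_ne_zero.2 (Measure.toSphere_ne_zero _))
    (measure_ne_top _ _)

variable {n : ℕ} (b : OrthonormalBasis (Fin n) ℝ (EuclideanSpace ℝ (Fin n))) (S : Finset (Fin n))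

/-- The squared norm of the projection of `y` to the span of the basis vectors `b i`, `i ∈ S`. -/
noncomputable def projSq (y : EuclideanSpace ℝ (Fin n)) : ℝ := ∑ i ∈ S, (b.repr y i) ^ 2

theorem continuous_projSq : Continuous (projSq b S) := by
  unfold projSq
  refine continuous_finsetSum _ fun i _ => ?_
  exact ((PiLp.continuous_apply 2 _ i).comp b.repr.continuous).pow 2

theorem sum_repr_sq (y : EuclideanSpace ℝ (Fin n)) : ∑ i, (b.repr y i) ^ 2 = ‖y‖ ^ 2 := by
  rw [← b.repr.norm_map y, EuclideanSpace.real_norm_sq_eq]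

theorem projSq_mem_Icc (v : Metric.sphere (0 : EuclideanSpace ℝ (Fin n)) 1) :
    projSq b S v ∈ Set.Icc (0 : ℝ) 1 := by
  refine ⟨Finset.sum_nonneg fun i _ => sq_nonneg _, ?_⟩
  have h := sum_repr_sq b v
  rw [norm_eq_of_mem_sphere, one_pow] at h
  refine le_of_le_of_eq ?_ h
  exact Finset.sum_le_sum_of_subset_of_nonneg (Finset.subset_univ S) fun i _ _ => sq_nonneg _

theorem projSq_smul (r : ℝ) (y : EuclideanSpace ℝ (Fin n)) :
    projSq b S (r • y) = r ^ 2 * projSq b S y := by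
  simp only [projSq, Finset.mul_sum, map_smul, PiLp.smul_apply, smul_eq_mul, mul_pow]

/-- The linear map that scales the basis vectors `b i`, `i ∈ S`, by `a` and fixes the others. -/
noncomputable def scaleMap (a : ℝ) : EuclideanSpace ℝ (Fin n) →ₗ[ℝ] EuclideanSpace ℝ (Fin n) :=
  Matrix.toLin b.toBasis b.toBasis (Matrix.diagonal fun i => if i ∈ S then a else 1)

theorem det_scaleMap (a : ℝ) : LinearMap.det (scaleMap b S a) = a ^ S.card := by
  rw [scaleMap, LinearMap.det_toLin, Matrix.det_diagonal, Finset.prod_ite_mem, Finset.univ_inter,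
    Finset.prod_const]

theorem repr_scaleMap (a : ℝ) (y : EuclideanSpace ℝ (Fin n)) (i : Fin n) :
    b.repr (scaleMap b S a y) i = (if i ∈ S then a else 1) * b.repr y i := by
  rw [← OrthonormalBasis.coe_toBasis_repr_apply, scaleMap, Matrix.repr_toLin, Matrix.mulVec_diagonal,
    OrthonormalBasis.coe_toBasis_repr_apply]

theorem projSq_scaleMap (a : ℝ) (y : EuclideanSpace ℝ (Fin n)) :
    projSq b S (scaleMap b S a y) = a ^ 2 * projSq b S y := by
  rw [projSq, projSq, Finset.mul_sum]
  refine Finset.sum_congr rfl fun i hi => ?_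
  rw [repr_scaleMap, if_pos hi, mul_pow]

theorem norm_scaleMap_sq (a : ℝ) (y : EuclideanSpace ℝ (Fin n)) :
    ‖scaleMap b S a y‖ ^ 2 = ‖y‖ ^ 2 + (a ^ 2 - 1) * projSq b S y := by
  rw [← sum_repr_sq b, ← sum_repr_sq b y, projSq, Finset.mul_sum,
    ← Finset.sum_filter_add_sum_filter_not Finset.univ (· ∈ S),
    ← Finset.sum_filter_add_sum_filter_not Finset.univ (· ∈ S) (fun i => (b.repr y i) ^ 2),
    Finset.filter_mem_eq_inter, Finset.univ_inter, add_right_comm, ← Finset.sum_add_distrib]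
  congr 1
  · refine Finset.sum_congr rfl fun i hi => ?_
    rw [repr_scaleMap, if_pos hi]
    ring
  · refine Finset.sum_congr rfl fun i hi => ?_
    rw [repr_scaleMap, if_neg (Finset.mem_filter.1 hi).2, one_mul]

/-- Change variables by `scaleMap` with factor `√β`. On the sphere its squared norm is `1 + (β - 1)
X` with `X = projSq`, so the normalized projection becomes `β X / (1 + (β - 1) X)`, the Jacobian
factor is the power `-n / 2` of the denominator, and the determinant is `β ^ (|S| / 2)`. -/
theorem projSq_transform (hn : 1 ≤ n) (s β : ℝ) (hβ : 0 < β) :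
    ∫ v, Real.exp (s * (β * projSq b S v / (1 + (β - 1) * projSq b S v))) *
      (1 + (β - 1) * projSq b S v) ^ (-((n : ℝ) / 2)) ∂(uniformSphere n) =
      β ^ (-((S.card : ℝ) / 2)) * ∫ v, Real.exp (s * projSq b S v) ∂(uniformSphere n) := by
  have : NeZero n := ⟨by omega⟩
  have hcont := continuous_projSq b S
  have hm : Measurable (projSq b S) := hcont.measurable
  set a := √β with ha
  have ha0 : 0 < a := Real.sqrt_pos.2 hβ
  have ha2 : a ^ 2 = β := Real.sq_sqrt hβ.le
  have hdet : LinearMap.det (scaleMap b S a) ≠ 0 := by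
    rw [det_scaleMap]; positivity
  let g : EuclideanSpace ℝ (Fin n) → ENNReal := fun y =>
    ENNReal.ofReal (Real.exp (s * (projSq b S y / ‖y‖ ^ 2)))
  have hg : Measurable g := by
    simp only [g]
    fun_prop
  have hg0 : ∀ (r : ℝ) (x : EuclideanSpace ℝ (Fin n)), 0 < r → g (r • x) = g x := by
    intro r x hr
    simp only [g]
    rw [projSq_smul, norm_smul, mul_pow, Real.norm_eq_abs, sq_abs,
      mul_div_mul_left _ _ (pow_ne_zero 2 hr.ne')]
  have key := lintegral_toSphere_linear (volume : Measure (EuclideanSpace ℝ (Fin n)))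
    (scaleMap b S a) hdet g hg hg0
  have hD : ∀ v : Metric.sphere (0 : EuclideanSpace ℝ (Fin n)) 1,
      ‖scaleMap b S a v‖ ^ 2 = 1 + (β - 1) * projSq b S v := by
    intro v
    rw [norm_scaleMap_sq, norm_eq_of_mem_sphere, ha2, one_pow]
  have hL : ∀ v : Metric.sphere (0 : EuclideanSpace ℝ (Fin n)) 1,
      g (scaleMap b S a v) * ENNReal.ofReal (‖scaleMap b S a v‖⁻¹ ^
        Module.finrank ℝ (EuclideanSpace ℝ (Fin n))) =
      ENNReal.ofReal (Real.exp (s * (β * projSq b S v / (1 + (β - 1) * projSq b S v))) *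
        (1 + (β - 1) * projSq b S v) ^ (-((n : ℝ) / 2))) := by
    intro v
    simp only [g]
    rw [← ENNReal.ofReal_mul (Real.exp_pos _).le, projSq_scaleMap, hD, ha2]
    congr 2
    rw [finrank_euclideanSpace_fin, ← hD, Real.rpow_neg (sq_nonneg _), ← Real.rpow_natCast _ 2,
      ← Real.rpow_mul (norm_nonneg _), inv_pow, ← Real.rpow_natCast]
    congr 2
    push_cast
    ring
  have hR : ∀ v : Metric.sphere (0 : EuclideanSpace ℝ (Fin n)) 1,
      g v = ENNReal.ofReal (Real.exp (s * projSq b S v)) := by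
    intro v
    simp only [g]
    rw [norm_eq_of_mem_sphere, one_pow, div_one]
  simp only [hL, hR] at key
  have hms : Measurable fun v : Metric.sphere (0 : EuclideanSpace ℝ (Fin n)) 1 => projSq b S v :=
    hm.comp measurable_subtype_coe
  rw [integral_eq_lintegral_of_nonneg_ae (Filter.Eventually.of_forall fun v => by
      change 0 ≤ _
      rw [← hD]
      positivity) (by fun_prop),
    integral_eq_lintegral_of_nonneg_ae (Filter.Eventually.of_forall fun v => (Real.exp_pos _).le)
      (by fun_prop), uniformSphere, lintegral_smul_measure, lintegral_smul_measure, key,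
    smul_eq_mul, smul_eq_mul, mul_left_comm, ENNReal.toReal_mul]
  congr 1
  rw [ENNReal.toReal_ofReal (abs_nonneg _), det_scaleMap, abs_of_pos (by positivity),
    Real.rpow_neg hβ.le, ha, Real.sqrt_eq_rpow, ← Real.rpow_natCast, ← Real.rpow_mul hβ.le]
  congr 2
  ring

/-- The Beta case `N = n / 2`, `α = |S| / 2`. The argument through Stein's identity also covers the
degenerate cases where `S` is empty or everything. -/
theorem hasSubgaussianMGF_projSq (hn : 1 ≤ n) :
    HasSubgaussianMGF (fun v : Metric.sphere (0 : EuclideanSpace ℝ (Fin n)) 1 =>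
      projSq b S v - S.card / n) (1 / (2 * n : ℝ)).toNNReal (uniformSphere n) := by
  have := isProbabilityMeasure_uniformSphere hn
  have hn' : (0 : ℝ) < n := by exact_mod_cast hn
  have hm : Measurable fun v : Metric.sphere (0 : EuclideanSpace ℝ (Fin n)) 1 => projSq b S v :=
    (continuous_projSq b S).measurable.comp measurable_subtype_coe
  have h := hasSubgaussianMGF_of_stein (uniformSphere n) _ hm (projSq_mem_Icc b S) ((n : ℝ) / 2)
    ((S.card : ℝ) / 2) (by positivity) fun s =>
      stein_of_transform (uniformSphere n) _ hm (projSq_mem_Icc b S) _ _ s fun β hβ =>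
        projSq_transform b S hn s β hβ
  have e1 : (4 * ((n : ℝ) / 2)) = 2 * n := by ring
  have e2 : (S.card : ℝ) / 2 / ((n : ℝ) / 2) = S.card / n := by field_simp
  rwa [e1, e2] at h

theorem specWeight_eq_repr_sq {A : Matrix (Fin n) (Fin n) ℝ} (hA : A.IsHermitian)
    (v : EuclideanSpace ℝ (Fin n)) (i : Fin n) :
    specWeight hA v i = (hA.eigenvectorBasis.repr v i) ^ 2 := by
  rw [specWeight, OrthonormalBasis.repr_apply_apply, EuclideanSpace.inner_eq_star_dotProduct,
    dotProduct_comm]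
  congr 1

theorem weightedCesm_eq_projSq {A : Matrix (Fin n) (Fin n) ℝ} (hA : A.IsHermitian)
    (v : EuclideanSpace ℝ (Fin n)) (x : ℝ) :
    weightedCesm hA v x =
      projSq hA.eigenvectorBasis (Finset.univ.filter fun i => hA.eigenvalues i ≤ x) v := by
  rw [weightedCesm_eq_sum, projSq, Finset.sum_filter]
  refine Finset.sum_congr rfl fun i _ => ?_
  rw [specWeight_eq_repr_sq]
  split_ifs <;> simp

theorem cesm_eq_card_div {A : Matrix (Fin n) (Fin n) ℝ} (hA : A.IsHermitian) (x : ℝ) :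
    cesm hA x = (Finset.univ.filter fun i => hA.eigenvalues i ≤ x).card / n := by
  rw [cesm, ← Finset.mul_sum, Finset.sum_boole]
  ring

/-- Two-sided Hoeffding bound for the averages of `projSq` over independent uniform vectors. -/
theorem measure_average_projSq_ge (hn : 1 ≤ n) {Ω : Type*} [MeasurableSpace Ω] (P : Measure Ω)
    [IsProbabilityMeasure P] {nv : ℕ} (hnv : 0 < nv)
    (v : Fin nv → Ω → Metric.sphere (0 : EuclideanSpace ℝ (Fin n)) 1)
    (hindep : iIndepFun v P) (hlaw : ∀ i, HasLaw (v i) (uniformSphere n) P) (ε : ℝ) (hε : 0 ≤ ε) :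
    P {ω | ε ≤ |S.card / n - (1 / (nv : ℝ)) * ∑ i, projSq b S (v i ω)|} ≤
      ENNReal.ofReal (2 * Real.exp (-(nv * n * ε ^ 2))) := by
  have hn' : (0 : ℝ) < n := by exact_mod_cast hn
  have hnv' : (0 : ℝ) < nv := by exact_mod_cast hnv
  let Y : Metric.sphere (0 : EuclideanSpace ℝ (Fin n)) 1 → ℝ := fun v => projSq b S v - S.card / n
  have hYm : Measurable Y :=
    ((continuous_projSq b S).measurable.comp measurable_subtype_coe).sub_const _
  have hY : ∀ i, HasSubgaussianMGF (Y ∘ v i) (1 / (2 * n : ℝ)).toNNReal P := fun i => by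
    refine HasSubgaussianMGF.of_map (hlaw i).aemeasurable ?_
    rw [(hlaw i).map_eq]
    exact hasSubgaussianMGF_projSq b S hn
  have hind : iIndepFun (fun i => Y ∘ v i) P := hindep.comp (fun _ => Y) fun _ => hYm
  have hsum := HasSubgaussianMGF.sum_of_iIndepFun hind (s := Finset.univ) fun i _ => hY i
  have hexp : -(nv * ε) ^ 2 / (2 * ((∑ _i : Fin nv, (1 / (2 * n : ℝ)).toNNReal : NNReal) : ℝ)) =
      -(nv * n * ε ^ 2) := by
    push_cast
    rw [Finset.sum_const, Finset.card_univ, Fintype.card_fin, Real.coe_toNNReal _ (by positivity),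
      nsmul_eq_mul]
    field_simp
  have h1 := hsum.measure_ge_le (ε := nv * ε) (by positivity)
  have h2 := hsum.neg.measure_ge_le (ε := nv * ε) (by positivity)
  rw [hexp] at h1 h2
  have hsub : {ω | ε ≤ |S.card / n - (1 / (nv : ℝ)) * ∑ i, projSq b S (v i ω)|} ⊆
      {ω | nv * ε ≤ ∑ i, (Y ∘ v i) ω} ∪ {ω | nv * ε ≤ (-fun ω => ∑ i, (Y ∘ v i) ω) ω} := by
    intro ω hω
    simp only [Set.mem_ofPred_eq] at hω
    have hsumY : ∑ i, (Y ∘ v i) ω =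
        -(nv * (S.card / n - (1 / (nv : ℝ)) * ∑ i, projSq b S (v i ω))) := by
      simp only [Y, Function.comp_apply, Finset.sum_sub_distrib, Finset.sum_const, Finset.card_univ,
        Fintype.card_fin, nsmul_eq_mul]
      field_simp
      ring
    rcases le_abs.1 hω with h | h
    · right
      simp only [Set.mem_ofPred_eq, Pi.neg_apply]
      rw [hsumY, neg_neg]
      exact mul_le_mul_of_nonneg_left h hnv'.le
    · left
      simp only [Set.mem_ofPred_eq]
      rw [hsumY, ← mul_neg]
      exact mul_le_mul_of_nonneg_left h hnv'.le
  refine (measure_mono hsub).trans ((measure_union_le _ _).trans ?_)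
  rw [two_mul, ENNReal.ofReal_add (Real.exp_pos _).le (Real.exp_pos _).le]
  refine add_le_add ?_ ?_
  · rw [← ofReal_measureReal]
    exact ENNReal.ofReal_le_ofReal h1
  · rw [← ofReal_measureReal]
    exact ENNReal.ofReal_le_ofReal h2

end UniformSphere

/-! ### Combining the sampling and quadrature errors -/

section Assembly

theorem wasserstein_triangle (F G H : ℝ → ℝ) (hF : Measurable F) (hG : Measurable G) :
    wasserstein F H ≤ wasserstein F G + wasserstein G H := by
  rw [wasserstein, wasserstein, wasserstein, ← lintegral_add_left (by fun_prop)]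
  refine lintegral_mono fun x => ?_
  rw [← ENNReal.ofReal_add (abs_nonneg _) (abs_nonneg _)]
  exact ENNReal.ofReal_le_ofReal (abs_sub_le _ _ _)

theorem wasserstein_average_le {m : ℕ} (hm : 0 < m) (F G : Fin m → ℝ → ℝ)
    (hF : ∀ i, Measurable (F i)) (hG : ∀ i, Measurable (G i)) (D : ℝ)
    (h : ∀ i, wasserstein (F i) (G i) ≤ ENNReal.ofReal D) :
    wasserstein (fun x => (1 / (m : ℝ)) * ∑ i, F i x) (fun x => (1 / (m : ℝ)) * ∑ i, G i x) ≤
      ENNReal.ofReal D := by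
  have hm' : (0 : ℝ) < m := by exact_mod_cast hm
  calc wasserstein (fun x => (1 / (m : ℝ)) * ∑ i, F i x) (fun x => (1 / (m : ℝ)) * ∑ i, G i x)
      ≤ ∫⁻ x, ∑ i, ENNReal.ofReal (1 / m) * ENNReal.ofReal |F i x - G i x| := by
        refine lintegral_mono fun x => ?_
        rw [← mul_sub, ← Finset.sum_sub_distrib, abs_mul, abs_of_pos (by positivity : (0 : ℝ) < 1 / m),
          ENNReal.ofReal_mul (by positivity), ← Finset.mul_sum,
          ← ENNReal.ofReal_sum_of_nonneg fun i _ => abs_nonneg _]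
        gcongr
        exact Finset.abs_sum_le_sum_abs _ _
    _ = ∑ i, ENNReal.ofReal (1 / m) * wasserstein (F i) (G i) := by
        rw [lintegral_finsetSum _ fun i _ => by have := hF i; have := hG i; fun_prop]
        refine Finset.sum_congr rfl fun i _ => ?_
        have := hF i
        have := hG i
        rw [lintegral_const_mul _ (by fun_prop), wasserstein]
    _ ≤ ∑ _i : Fin m, ENNReal.ofReal (1 / m) * ENNReal.ofReal D := by
        gcongr with i
        exact h i
    _ = ENNReal.ofReal D := by
        rw [Finset.sum_const, Finset.card_univ, Fintype.card_fin, nsmul_eq_mul, ← mul_assoc,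
          ← ENNReal.ofReal_natCast, ← ENNReal.ofReal_mul hm'.le, mul_one_div_cancel hm'.ne',
          ENNReal.ofReal_one, one_mul]

variable {n : ℕ} {A : Matrix (Fin n) (Fin n) ℝ} (hA : A.IsHermitian)

theorem measurable_weightedCesm (w : Fin n → ℝ) : Measurable (weightedCesm hA w) := by
  have : weightedCesm hA w = stepFun (specWeight hA w) hA.eigenvalues :=
    funext fun x => weightedCesm_eq_sum hA w x
  rw [this]
  exact measurable_stepFun _ _

theorem measurable_cesm : Measurable (cesm hA) := measurable_stepFun (fun _ => 1 / (n : ℝ)) _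

theorem iInf_le_eigenvalues_le_iSup (i : Fin n) :
    (⨅ i, hA.eigenvalues i) ≤ hA.eigenvalues i ∧ hA.eigenvalues i ≤ ⨆ i, hA.eigenvalues i :=
  ⟨ciInf_le (Set.finite_range _).bddBelow i, le_ciSup (Set.finite_range _).bddAbove i⟩

/-- The average of the weighted spectral measures of `A` for the given vectors. -/
noncomputable def averageCesm {m : ℕ} (v : Fin m → EuclideanSpace ℝ (Fin n)) (x : ℝ) : ℝ :=
  (1 / (m : ℝ)) * ∑ i, weightedCesm hA (v i) x

/-- Outside `[λ_min, λ_max)` both functions are 0 or both are 1, as the vectors are unit. Inside,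
both are constant between consecutive eigenvalues, so control at the eigenvalues below the largest
is control everywhere. -/
theorem wasserstein_cesm_averageCesm_le (hn : 1 ≤ n) {m : ℕ} (hm : 0 < m)
    (v : Fin m → Metric.sphere (0 : EuclideanSpace ℝ (Fin n)) 1) (D : ℝ) (hD : 0 ≤ D)
    (h : ∀ i, hA.eigenvalues i < (⨆ i, hA.eigenvalues i) →
      |cesm hA (hA.eigenvalues i) - averageCesm hA (fun i => (v i : EuclideanSpace ℝ (Fin n)))
        (hA.eigenvalues i)| ≤ D) :
    wasserstein (cesm hA) (averageCesm hA fun i => (v i : EuclideanSpace ℝ (Fin n))) ≤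
      ENNReal.ofReal (D * spectralWidth hA) := by
  have hn' : (n : ℝ) ≠ 0 := by positivity
  have hm' : (m : ℝ) ≠ 0 := by positivity
  set lo := ⨅ i, hA.eigenvalues i with hlo
  set hi := ⨆ i, hA.eigenvalues i with hhi
  have hle : lo ≤ hi := (iInf_le_eigenvalues_le_iSup hA ⟨0, hn⟩).1.trans
    (iInf_le_eigenvalues_le_iSup hA ⟨0, hn⟩).2
  have hpt : ∀ x, ENNReal.ofReal |cesm hA x -
      averageCesm hA (fun i => (v i : EuclideanSpace ℝ (Fin n))) x| ≤
      (Set.Ico lo hi).indicator (fun _ => ENNReal.ofReal D) x := by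
    intro x
    rcases lt_or_ge x lo with hx | hx
    · have hfil : (Finset.univ.filter fun i => hA.eigenvalues i ≤ x) = ∅ :=
        Finset.filter_eq_empty_iff.2 fun i _ =>
          not_le.2 (hx.trans_le (iInf_le_eigenvalues_le_iSup hA i).1)
      simp [averageCesm, cesm_eq_card_div, weightedCesm_eq_projSq, hfil, projSq]
    rcases le_or_gt hi x with hx' | hx'
    · have hfil : (Finset.univ.filter fun i => hA.eigenvalues i ≤ x) = Finset.univ :=
        Finset.filter_eq_self.2 fun i _ => (iInf_le_eigenvalues_le_iSup hA i).2.trans hx'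
      have : averageCesm hA (fun i => (v i : EuclideanSpace ℝ (Fin n))) x = 1 := by
        simp only [averageCesm, weightedCesm_eq_projSq, hfil, projSq, sum_repr_sq,
          norm_eq_of_mem_sphere, one_pow, Finset.sum_const, Finset.card_univ, Fintype.card_fin,
          nsmul_eq_mul]
        field_simp
      rw [this, cesm_eq_card_div, hfil, Finset.card_univ, Fintype.card_fin, div_self hn']
      simp
    · rw [Set.indicator_of_mem (show x ∈ Set.Ico lo hi from ⟨hx, hx'⟩)]
      refine ENNReal.ofReal_le_ofReal ?_
      have hne : (Finset.univ.filter fun i => hA.eigenvalues i ≤ x).Nonempty := by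
        have : Nonempty (Fin n) := ⟨⟨0, hn⟩⟩
        obtain ⟨i, hi⟩ := exists_eq_ciInf_of_finite (f := hA.eigenvalues)
        exact ⟨i, Finset.mem_filter.2 ⟨Finset.mem_univ i, hi.le.trans hx⟩⟩
      -- The largest eigenvalue not exceeding `x`: both functions take the same value there as at
      -- `x`.
      obtain ⟨i, hi, hmax⟩ := Finset.exists_max_image _ hA.eigenvalues hne
      have hix := (Finset.mem_filter.1 hi).2
      have hfil : (Finset.univ.filter fun j => hA.eigenvalues j ≤ x) =
          Finset.univ.filter fun j => hA.eigenvalues j ≤ hA.eigenvalues i :=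
        Finset.filter_congr fun j _ => ⟨fun hj => hmax j (Finset.mem_filter.2 ⟨Finset.mem_univ j, hj⟩),
          fun hj => hj.trans hix⟩
      have := h i (hix.trans_lt hx')
      simp only [averageCesm, cesm_eq_card_div, weightedCesm_eq_projSq, hfil] at this ⊢
      exact this
  refine (lintegral_mono hpt).trans (le_of_eq ?_)
  rw [lintegral_indicator_const measurableSet_Ico, Real.volume_Ico, ← ENNReal.ofReal_mul hD,
    spectralWidth, abs_of_nonneg (sub_nonneg.2 hle)]

theorem wasserstein_averageCesm_output_le (reorth : Bool) {m : ℕ} (hm : 0 < m)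
    (v : Fin m → Metric.sphere (0 : EuclideanSpace ℝ (Fin n)) 1) (k : ℕ) (hk : 1 ≤ k) :
    wasserstein (averageCesm hA fun i => (v i : EuclideanSpace ℝ (Fin n)))
      (output A reorth k fun i => (v i : EuclideanSpace ℝ (Fin n))) ≤
      ENNReal.ofReal (spectralWidth hA * (Real.pi / (2 * k + 1))) :=
  wasserstein_average_le hm _ _ (fun _ => measurable_weightedCesm hA _)
    (fun _ => measurable_weightedCesm _ _) _ fun i =>
      wasserstein_lanczosQuadrature_le A hA reorth (v i) (norm_eq_of_mem_sphere _) k hk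

/-- The exponent has `n · 9/16` where the sample size was chosen for `(n + 2) / 4`; the former
dominates as soon as `5 n ≥ 8`, which is why `n = 1` is excluded. -/
theorem natCast_mul_two_mul_exp_lt (hn : 2 ≤ n) (η t : ℝ) (hη : 0 < η) (ht : 0 < t) (nv : ℕ)
    (hnv : 4 * ((n : ℝ) + 2)⁻¹ * (t ^ 2)⁻¹ * Real.log (2 * n * η⁻¹) < nv) :
    n * (2 * Real.exp (-(nv * n * (3 / 4 * t) ^ 2))) < η := by
  have hn' : (2 : ℝ) ≤ n := by exact_mod_cast hn
  have h1 : Real.log (2 * n * η⁻¹) < nv * n * (3 / 4 * t) ^ 2 := by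
    have h2 : 4 * ((n : ℝ) + 2)⁻¹ * (t ^ 2)⁻¹ * Real.log (2 * n * η⁻¹) =
        Real.log (2 * n * η⁻¹) / ((n + 2) * t ^ 2 / 4) := by
      field_simp
    rw [h2, div_lt_iff₀ (by positivity)] at hnv
    refine hnv.trans_le ?_
    rw [mul_assoc]
    refine mul_le_mul_of_nonneg_left ?_ (Nat.cast_nonneg _)
    nlinarith [mul_nonneg (sub_nonneg.2 hn') (sq_nonneg t), sq_nonneg t]
  have h3 : 0 < 2 * n * η⁻¹ := by positivity
  have h4 := Real.exp_lt_exp.2 (neg_lt_neg h1)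
  rw [Real.exp_neg (Real.log _), Real.exp_log h3] at h4
  calc n * (2 * Real.exp (-(nv * n * (3 / 4 * t) ^ 2))) < n * (2 * (2 * n * η⁻¹)⁻¹) := by
        gcongr
    _ = η := by field_simp

end Assembly
end SLQ

/-! ### The main theorem -/

theorem mainTheorem1 {n : ℕ} (hn : 1 ≤ n) (A : Matrix (Fin n) (Fin n) ℝ) (hA : A.IsHermitian)
    (η t : ℝ) (hη0 : 0 < η) (hη1 : η < 1) (ht : 0 < t)
    (nv k : ℕ)
    (hnv : 4 * ((n : ℝ) + 2)⁻¹ * (t ^ 2)⁻¹ * Real.log (2 * n * η⁻¹) < nv)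
    (hk : 12 * t⁻¹ + 1 / 2 < (k : ℝ))
    (reorth : Bool)
    {Ω : Type*} [MeasurableSpace Ω] (P : MeasureTheory.Measure Ω)
    [MeasureTheory.IsProbabilityMeasure P]
    (v : Fin nv → Ω → Metric.sphere (0 : EuclideanSpace ℝ (Fin n)) 1)
    (hindep : ProbabilityTheory.iIndepFun v P)
    (hlaw : ∀ i, ProbabilityTheory.HasLaw (v i) (SLQ.uniformSphere n) P) :
    P {ω | ENNReal.ofReal (t * SLQ.spectralWidth hA) <
        SLQ.wasserstein (SLQ.cesm hA)
          (SLQ.output A reorth k (fun i => (v i ω : EuclideanSpace ℝ (Fin n))))} <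
      ENNReal.ofReal η := by
  have hn' : (1 : ℝ) ≤ n := by exact_mod_cast hn
  have htinv : 0 < t⁻¹ := inv_pos.2 ht
  have hk1 : 1 ≤ k := by
    have : (0 : ℝ) < k := by linarith
    exact_mod_cast this
  have hnv0 : 0 < nv := by
    have hlog : 0 < Real.log (2 * n * η⁻¹) := by
      apply Real.log_pos
      have : 1 < η⁻¹ := (one_lt_inv₀ hη0).2 hη1
      nlinarith
    have h : (0 : ℝ) < nv := lt_trans (by positivity) hnv
    exact_mod_cast h
  have hI : 0 ≤ SLQ.spectralWidth hA := abs_nonneg _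
  -- The quadrature share of the budget: `k t > 12` gives `(2k + 1) t > 24`, more than `4 π`.
  have hquad : Real.pi / (2 * k + 1) ≤ t / 4 := by
    have h12 : 12 < k * t := by
      have := mul_lt_mul_of_pos_right hk ht
      rw [add_mul, mul_assoc, inv_mul_cancel₀ ht.ne'] at this
      linarith
    rw [div_le_div_iff₀ (by positivity) (by norm_num)]
    nlinarith [Real.pi_lt_four]
  -- The largest eigenvalue is left out because both functions equal 1 there.
  set s : Finset (Fin n) :=
    Finset.univ.filter fun i => hA.eigenvalues i < ⨆ i, hA.eigenvalues i with hs
  let bad : Fin n → Set Ω := fun i =>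
    {ω | 3 / 4 * t ≤ |((Finset.univ.filter fun j => hA.eigenvalues j ≤ hA.eigenvalues i).card : ℝ) / n
      - (1 / (nv : ℝ)) * ∑ l, SLQ.projSq hA.eigenvectorBasis
        (Finset.univ.filter fun j => hA.eigenvalues j ≤ hA.eigenvalues i) (v l ω)|}
  have hsub : {ω | ENNReal.ofReal (t * SLQ.spectralWidth hA) <
        SLQ.wasserstein (SLQ.cesm hA)
          (SLQ.output A reorth k (fun i => (v i ω : EuclideanSpace ℝ (Fin n))))} ⊆
      ⋃ i ∈ s, bad i := by
    intro ω hω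
    by_contra hnot
    simp only [Set.mem_iUnion, not_exists] at hnot
    rw [Set.mem_ofPred_eq, ← not_le] at hω
    refine hω ?_
    have h1 := SLQ.wasserstein_cesm_averageCesm_le hA hn hnv0 (fun i => v i ω) (3 / 4 * t)
      (by positivity) fun i hi => by
        have := hnot i (Finset.mem_filter.2 ⟨Finset.mem_univ i, hi⟩)
        simp only [bad, Set.mem_ofPred_eq, not_le] at this
        simp only [SLQ.averageCesm, SLQ.cesm_eq_card_div, SLQ.weightedCesm_eq_projSq]
        exact this.le
    have h2 := SLQ.wasserstein_averageCesm_output_le hA reorth hnv0 (fun i => v i ω) k hk1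
    have hmeas : Measurable (SLQ.averageCesm hA fun i => (v i ω : EuclideanSpace ℝ (Fin n))) :=
      (Finset.measurable_sum _ fun i _ => SLQ.measurable_weightedCesm hA _).const_mul _
    refine (SLQ.wasserstein_triangle _ _ _ (SLQ.measurable_cesm hA) hmeas).trans
      ((add_le_add h1 h2).trans ?_)
    rw [← ENNReal.ofReal_add (by positivity) (by positivity)]
    refine ENNReal.ofReal_le_ofReal ?_
    nlinarith [mul_le_mul_of_nonneg_left hquad hI]
  have hbad : ∀ i, P (bad i) ≤ ENNReal.ofReal (2 * Real.exp (-(nv * n * (3 / 4 * t) ^ 2))) :=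
    fun i => SLQ.measure_average_projSq_ge _ _ hn P hnv0 v hindep hlaw _ (by positivity)
  refine (MeasureTheory.measure_mono hsub).trans_lt
    ((MeasureTheory.measure_biUnion_finset_le s bad).trans_lt ?_)
  rcases s.eq_empty_or_nonempty with hempty | ⟨i, hi⟩
  · rw [hempty, Finset.sum_empty]
    exact ENNReal.ofReal_pos.2 hη0
  -- For `n = 1` the only eigenvalue is the largest one, so a nonempty union forces `n ≥ 2`.
  · have hn2 : 2 ≤ n := by
      by_contra hlt
      obtain rfl : n = 1 := by omega
      have := (Finset.mem_filter.1 hi).2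
      rw [Subsingleton.elim i 0] at this
      simp at this
    calc ∑ i ∈ s, P (bad i)
        ≤ ∑ _i ∈ s, ENNReal.ofReal (2 * Real.exp (-(nv * n * (3 / 4 * t) ^ 2))) :=
          Finset.sum_le_sum fun i _ => hbad i
      _ ≤ ∑ _i : Fin n, ENNReal.ofReal (2 * Real.exp (-(nv * n * (3 / 4 * t) ^ 2))) :=
          Finset.sum_le_sum_of_subset (Finset.subset_univ s)
      _ = ENNReal.ofReal (n * (2 * Real.exp (-(nv * n * (3 / 4 * t) ^ 2)))) := by
          rw [Finset.sum_const, Finset.card_univ, Fintype.card_fin, nsmul_eq_mul,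
            ENNReal.ofReal_mul (Nat.cast_nonneg n), ENNReal.ofReal_natCast]
      _ < ENNReal.ofReal η := (ENNReal.ofReal_lt_ofReal_iff hη0).2
          (SLQ.natCast_mul_two_mul_exp_lt hn2 η t hη0 ht nv hnv)
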